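/- Let $n\ge 1$, $S^1=\mathbb{R}/2\pi\mathbb{Z}$, let $\sigma$ be Lebesgue measure on $S^1$, and put $\operatorname{sgn}v=v/|v|$ for $0\ne v\in\mathbb{R}^n$, $\operatorname{sgn}0=0$. For (the continuous representative of) $\psi\in W^{1,2}(S^1\to\mathbb{R}^n)$ let $Z[\psi]=\{s\in S^1:\psi(s)=0\}$. The relaxed oval problem in harmonic coordinates is to minimize $$I[\psi]=\int_{S^1}|\psi'|^2\,ds$$ among all $\psi\in W^{1,2}(S^1\to\mathbb{R}^n)$ with $\int_{S^1}|\psi|^2\,ds=1$ that satisfy the weak loop condition $$\Bigl|\int_{S^1}\operatorname{sgn}\psi\,ds\Bigr|\le\sigma(Z[\psi]).$$ A closed curve $x\in W^{1,\infty}(S^1\to\mathbb{R}^n)$ with $|x'|=1$ a.e. is called associated with $\psi$ if $\psi=\varphi\,x'$ a.e., where $\varphi:=|\psi|$. A di-gon is a straight segment of length $\pi$ traversed once back and forth. **Theorem (Existence and Classification).** The minimum in this problem is attained, by some $\psi$ with $I[\psi]\le 1$. Every minimizer $\psi$ has an associated curve, and for every minimizer $\psi$ and every associated curve $x$ one of the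 following holds: (a) $Z[\psi]=\emptyset$, and $x\in W^{2,2}(S^1\to\mathbb{R}^n)$. (b) $Z[\psi]$ is a closed interval of length $<\pi$, possibly degenerating to a single point; the weak loop condition holds with equality; $x$ runs along a straight segment over $Z[\psi]$ (a void condition if $Z[\psi]$ is a single point), with $\varphi\equiv0$ there; and $x\in W^{2,2}_{\rm loc}(S^1\setminus Z[\psi])$. (c1) $Z[\psi]$ is a closed interval of length exactly $\pi$; $x$ is a di-gon with its vertices at the end points of $Z[\psi]$; and $\varphi$ is supported on the other side of the di-gon, being nonzero exactly on $S^1\setminus Z[\psi]$. (c2) $Z[\psi]$ consists of two points at distance exactly $\pi$ along $S^1$; $x$ is a di-gon with its vertices at these two points; and $\varphi$ is nonzero exactly on the two open sides of the di-gon. -/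

import Mathlib

open MeasureTheory

noncomputable section

namespace OvalProblem

/-- The circle `ℝ / 2πℤ`; its `volume` is Lebesgue measure, of total mass `2π`. -/
abbrev S1 : Type := AddCircle (2 * Real.pi)

instance instFactTwoPiPos : Fact (0 < 2 * Real.pi) := ⟨Real.two_pi_pos⟩

/-- `ℝⁿ` with the Euclidean norm. -/
abbrev E (n : ℕ) : Type := EuclideanSpace ℝ (Fin n)

/-- The derivative of a function on the circle with respect to arclength
(used only where it exists almost everywhere). -/
def circleDeriv {n : ℕ} (u : S1 → E n) (s : S1) : E n :=
  deriv (fun t : ℝ => u (s + (t : S1))) 0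

/-- `u ∈ W^{1,2}(S¹ → ℝⁿ)`, for the continuous representative: `u` is the indefinite integral of a
(weak) derivative `g ∈ L²`. -/
def MemW12 {n : ℕ} (u : S1 → E n) : Prop :=
  ∃ g : S1 → E n, MemLp g 2 volume ∧
    ∀ a b : ℝ, u (b : S1) - u (a : S1) = ∫ t in a..b, g (t : S1)

/-- `x ∈ W^{2,2}(S¹ → ℝⁿ)`: the derivative `v` of `x` is in `W^{1,2}`. -/
def MemW22 {n : ℕ} (x : S1 → E n) : Prop :=
  ∃ v : S1 → E n, MemW12 v ∧
    ∀ a b : ℝ, x (b : S1) - x (a : S1) = ∫ t in a..b, v (t : S1)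

/-- `u ∈ W^{2,2}([a, b] → ℝⁿ)`, with (continuous) first derivative `v` and second derivative
`w ∈ L²`. -/
def MemW22On {n : ℕ} (u : ℝ → E n) (a b : ℝ) : Prop :=
  ∃ v w : ℝ → E n, MemLp w 2 (volume.restrict (Set.Icc a b)) ∧
    (∀ s ∈ Set.Icc a b, ∀ t ∈ Set.Icc a b, v t - v s = ∫ r in s..t, w r) ∧
    (∀ s ∈ Set.Icc a b, ∀ t ∈ Set.Icc a b, u t - u s = ∫ r in s..t, v r)

/-- `x ∈ W^{2,2}_loc(U → ℝⁿ)` for an open set `U` of the circle: `x` is in `W^{2,2}` on each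
compact interval contained in `U`. -/
def MemW22Loc {n : ℕ} (x : S1 → E n) (U : Set S1) : Prop :=
  ∀ a b : ℝ, a ≤ b → (∀ t ∈ Set.Icc a b, (t : S1) ∈ U) → MemW22On (fun t : ℝ => x (t : S1)) a b

/-- `sgn v = v / |v|` for `v ≠ 0`, and `sgn 0 = 0`. -/
def sgn {n : ℕ} (v : E n) : E n := ‖v‖⁻¹ • v

/-- The zero set `Z[ψ]`. -/
def zeroSet {n : ℕ} (ψ : S1 → E n) : Set S1 := {s | ψ s = 0}

/-- The functional `I[ψ] = ∫ |ψ'|²`. -/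
def energy {n : ℕ} (ψ : S1 → E n) : ℝ := ∫ s : S1, ‖circleDeriv ψ s‖ ^ 2

/-- The domain of the relaxed oval problem in harmonic coordinates. -/
structure Admissible {n : ℕ} (ψ : S1 → E n) : Prop where
  memW12 : MemW12 ψ
  normalized : ∫ s : S1, ‖ψ s‖ ^ 2 = 1
  /-- The weak loop condition. -/
  weakLoop : ‖∫ s : S1, sgn (ψ s)‖ ≤ volume.real (zeroSet ψ)

/-- `ψ` is a minimizer of the relaxed oval problem in harmonic coordinates. -/
def IsMinimizer {n : ℕ} (ψ : S1 → E n) : Prop :=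
  Admissible ψ ∧ ∀ χ : S1 → E n, Admissible χ → energy ψ ≤ energy χ

/-- The function `φ = |ψ|` on the curve associated with `ψ`. -/
def amplitude {n : ℕ} (ψ : S1 → E n) (s : S1) : ℝ := ‖ψ s‖

/-- `x` is a closed curve of length `2π`, parametrized by arclength, that is associated with `ψ`:
`x ∈ W^{1,∞}` (that is, Lipschitz), `|x'| = 1`, and `ψ = φ x'` with `φ = |ψ|`. -/
structure IsAssociatedCurve {n : ℕ} (ψ x : S1 → E n) : Prop where
  lipschitz : ∃ K : NNReal, LipschitzWith K x
  unitSpeed : ∀ᵐ s : S1, ‖circleDeriv x s‖ = 1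
  eq_smul : ∀ᵐ s : S1, ψ s = amplitude ψ s • circleDeriv x s

/-- The closed arc of the circle from `a` to `b`. -/
def arc (a b : ℝ) : Set S1 := (fun t : ℝ => (t : S1)) '' Set.Icc a b

/-- The open arc of the circle from `a` to `b`. -/
def openArc (a b : ℝ) : Set S1 := (fun t : ℝ => (t : S1)) '' Set.Ioo a b

/-- On the parameter interval `[a, b]`, `x` runs along a straight segment with unit speed. -/
def IsStraightOn {n : ℕ} (x : S1 → E n) (a b : ℝ) : Prop :=
  ∃ v : E n, ‖v‖ = 1 ∧ ∀ t ∈ Set.Icc a b, x (t : S1) = x (a : S1) + (t - a) • v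

/-- `x` is a di-gon with its vertices at the parameters `a` and `a + π`: a straight segment of
length `π`, traversed forth over `[a, a + π]` and back over `[a + π, a + 2π]`. -/
def IsDigon {n : ℕ} (x : S1 → E n) (a : ℝ) : Prop :=
  ∃ v : E n, ‖v‖ = 1 ∧
    (∀ t ∈ Set.Icc 0 Real.pi, x ((a + t : ℝ) : S1) = x (a : S1) + t • v) ∧
    (∀ t ∈ Set.Icc Real.pi (2 * Real.pi),
      x ((a + t : ℝ) : S1) = x (a : S1) + (2 * Real.pi - t) • v)

/-- Case (a): the zero set is empty, and the curve is `W^{2,2}`. -/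
def CaseA {n : ℕ} (ψ x : S1 → E n) : Prop :=
  zeroSet ψ = ∅ ∧ MemW22 x

/-- Case (b), D-shaped: the zero set is a closed interval of length `< π`, possibly one point;
equality holds in the weak loop condition; the curve is straight over the zero set, where `φ = 0`;
and it is `W^{2,2}_loc` off the zero set. -/
def CaseB {n : ℕ} (ψ x : S1 → E n) : Prop :=
  ∃ a b : ℝ, a ≤ b ∧ b - a < Real.pi ∧ zeroSet ψ = arc a b ∧
    ‖∫ s : S1, sgn (ψ s)‖ = volume.real (zeroSet ψ) ∧
    IsStraightOn x a b ∧ (∀ s ∈ arc a b, amplitude ψ s = 0) ∧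
    MemW22Loc x (zeroSet ψ)ᶜ

/-- Case (c1): the zero set is a closed interval of length `π`; the curve is a di-gon, and `φ` lives
on one side of it. -/
def CaseC1 {n : ℕ} (ψ x : S1 → E n) : Prop :=
  ∃ a : ℝ, zeroSet ψ = arc a (a + Real.pi) ∧ IsDigon x a ∧
    Function.support (amplitude ψ) = openArc (a + Real.pi) (a + 2 * Real.pi)

/-- Case (c2): the zero set consists of two points at distance `π` along the circle; the curve is a
di-gon, and `φ` lives on both sides of it. -/
def CaseC2 {n : ℕ} (ψ x : S1 → E n) : Prop :=
  ∃ a : ℝ, zeroSet ψ = {(a : S1), ((a + Real.pi : ℝ) : S1)} ∧ IsDigon x a ∧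
    Function.support (amplitude ψ) =
      openArc a (a + Real.pi) ∪ openArc (a + Real.pi) (a + 2 * Real.pi)

end OvalProblem

end

/-! Existence is by the direct method. Along a minimizing sequence the derivatives converge weakly
in L² and the functions pointwise. The weak loop condition survives the limit, because the direction
vectors lost where the limit vanishes are paid for by its larger zero set (`weakLoop_of_tendsto`). A
sine wave on a di-gon has energy 1 and bounds the minimum.

For the classification, call a component of {ψ ≠ 0} a block when Z[ψ] is nonempty. Replacing ψ by
zero on or off a block keeps the weak loop condition, and energy and mass split additively, so each
block alone is, after normalization, a minimizer (`IsMinimizer.exists_isMinimizer_block`). If a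
single block of length ℓ had strict inequality in the loop condition, it could be varied freely and
would solve ψ'' = -ω²ψ with ω² = I ≤ 1. It would be half a sine wave in a fixed direction, so ℓ ≥ π
and |∫ sgn ψ| = ℓ ≥ 2π - ℓ = σ(Z), a contradiction (`IsMinimizer.norm_integral_sgn_eq_of_block`).

Hence the integral of sgn ψ over each block has norm 2π - ℓ. It is also at most ℓ, so ℓ ≥ π. Thus
Z[ψ] is empty, or there is one block, or there are two blocks of length π. A block with ℓ = π is an
equality case of the triangle inequality: its direction is constant, which gives a di-gon. In all
cases the loop condition is an equality, so an associated curve crosses Z[ψ] with one constant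
velocity (`IsAssociatedCurve.isPrimitive`); off Z[ψ] its velocity sgn ψ inherits the regularity of
ψ. -/

noncomputable section

namespace OvalProblem

/-! ### Absolute continuity and the fundamental theorem for vector-valued functions -/

section AbsolutelyContinuous

theorem absolutelyContinuousOnInterval_of_dist_le {X Y : Type*} [PseudoMetricSpace X]
    [PseudoMetricSpace Y] {f : ℝ → X} {h : ℝ → Y} {a b : ℝ}
    (hh : AbsolutelyContinuousOnInterval h a b)
    (H : ∀ s ∈ Set.uIcc a b, ∀ t ∈ Set.uIcc a b, dist (f s) (f t) ≤ dist (h s) (h t)) :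
    AbsolutelyContinuousOnInterval f a b := by
  rw [absolutelyContinuousOnInterval_iff] at hh ⊢
  intro ε hε
  obtain ⟨δ, hδ, hD⟩ := hh ε hε
  refine ⟨δ, hδ, fun I hI hlen => lt_of_le_of_lt ?_ (hD I hI hlen)⟩
  exact Finset.sum_le_sum fun i hi => H _ (hI.1 i hi).1 _ (hI.1 i hi).2

variable {F : Type*} [NormedAddCommGroup F] [NormedSpace ℝ F]

omit [NormedSpace ℝ F] in
theorem dist_le_dist_intervalIntegral {h : ℝ → ℝ} {a b s t : ℝ}
    (hh : IntervalIntegrable h volume a b)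
    (hs : s ∈ Set.uIcc a b) (ht : t ∈ Set.uIcc a b) {f : ℝ → F}
    (H : ∀ s ∈ Set.uIcc a b, ∀ t ∈ Set.uIcc a b, s ≤ t → ‖f t - f s‖ ≤ ∫ r in s..t, h r) :
    dist (f s) (f t) ≤ dist (∫ r in a..s, h r) (∫ r in a..t, h r) := by
  have key : ∀ s ∈ Set.uIcc a b, ∀ t ∈ Set.uIcc a b, s ≤ t →
      dist (f s) (f t) ≤ dist (∫ r in a..s, h r) (∫ r in a..t, h r) := by
    intro s hs t ht hst
    have hi : ∀ r ∈ Set.uIcc a b, IntervalIntegrable h volume a r := fun r hr =>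
      hh.mono_set (Set.uIcc_subset_uIcc_left hr)
    rw [dist_comm, dist_comm (∫ r in a..s, h r), dist_eq_norm, dist_eq_norm,
      intervalIntegral.integral_interval_sub_left (hi t ht) (hi s hs)]
    exact (H s hs t ht hst).trans (le_abs_self _)
  rcases le_total s t with hst | hst
  · exact key s hs t ht hst
  · rw [dist_comm, dist_comm (∫ r in a..s, h r)]
    exact key t ht s hs hst

/-- Increments are dominated by those of the scalar primitive of ‖g‖. -/
theorem absolutelyContinuousOnInterval_intervalIntegral {g : ℝ → F} {a b : ℝ}
    (hg : IntervalIntegrable g volume a b) :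
    AbsolutelyContinuousOnInterval (fun t => ∫ r in a..t, g r) a b := by
  refine absolutelyContinuousOnInterval_of_dist_le
    (hg.norm.absolutelyContinuousOnInterval_intervalIntegral (c := a) Set.left_mem_uIcc) ?_
  intro s hs t ht
  refine dist_le_dist_intervalIntegral (f := fun t => ∫ r in a..t, g r) hg.norm hs ht ?_
  intro s hs t ht hst
  have hi : ∀ r ∈ Set.uIcc a b, IntervalIntegrable g volume a r := fun r hr =>
    hg.mono_set (Set.uIcc_subset_uIcc_left hr)
  rw [intervalIntegral.integral_interval_sub_left (hi t ht) (hi s hs)]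
  exact intervalIntegral.norm_integral_le_integral_norm hst

/-- The difference of f and the primitive of f' is absolutely continuous with zero derivative a.e.,
hence constant. -/
theorem integral_eq_sub_of_ae_hasDerivAt [CompleteSpace F] {f f' : ℝ → F} {a b : ℝ}
    (hf : AbsolutelyContinuousOnInterval f a b) (hf' : IntervalIntegrable f' volume a b)
    (h : ∀ᵐ x, x ∈ Set.uIcc a b → HasDerivAt f (f' x) x) :
    ∫ t in a..b, f' t = f b - f a := by
  have hac := hf.sub (absolutelyContinuousOnInterval_intervalIntegral hf')
  obtain ⟨C, hC⟩ := hac.const_of_ae_hasDerivAt_zero (by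
    filter_upwards [h, hf'.ae_hasDerivAt_integral] with x hx hx' hxm
    simpa using (hx hxm).sub (hx' hxm a Set.left_mem_uIcc))
  have h1 := hC a Set.left_mem_uIcc
  have h2 := hC b Set.right_mem_uIcc
  simp only [Pi.sub_apply, intervalIntegral.integral_same, sub_zero] at h1 h2
  rw [h1, ← h2]
  abel

theorem norm_deriv_le_of_dist_le {f : ℝ → F} {h : ℝ → ℝ} {x : ℝ} {f' : F} {h' : ℝ}
    (hf : HasDerivAt f f' x) (hh : HasDerivAt h h' x)
    (H : ∀ᶠ t in nhds x, dist (f t) (f x) ≤ dist (h t) (h x)) : ‖f'‖ ≤ ‖h'‖ := by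
  refine le_of_tendsto_of_tendsto hf.tendsto_slope.norm hh.tendsto_slope.norm ?_
  filter_upwards [H.filter_mono nhdsWithin_le_nhds] with t ht
  rw [slope_def_module, slope_def_module, norm_smul, norm_smul, ← dist_eq_norm, ← dist_eq_norm]
  exact mul_le_mul_of_nonneg_left ht (norm_nonneg _)

/-- The bound on increments gives absolute continuity and also dominates the derivative. It serves
both Lipschitz curves and sgn ψ away from the zeros. -/
theorem ftc_of_norm_sub_le [FiniteDimensional ℝ F] {f : ℝ → F} {h : ℝ → ℝ} {a b : ℝ}
    (hab : a ≤ b) (hh : IntervalIntegrable h volume a b)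
    (H : ∀ s t, a ≤ s → s ≤ t → t ≤ b → ‖f t - f s‖ ≤ ∫ r in s..t, h r) :
    IntervalIntegrable (deriv f) volume a b ∧
    (∀ᵐ t, t ∈ Set.Icc a b → ‖deriv f t‖ ≤ ‖h t‖) ∧
    ∀ s ∈ Set.Icc a b, ∀ t ∈ Set.Icc a b, f t - f s = ∫ r in s..t, deriv f r := by
  have hcomp : CompleteSpace F := FiniteDimensional.complete ℝ F
  have H' : ∀ s ∈ Set.uIcc a b, ∀ t ∈ Set.uIcc a b, s ≤ t → ‖f t - f s‖ ≤ ∫ r in s..t, h r := by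
    rw [Set.uIcc_of_le hab]
    exact fun s hs t ht hst => H s t hs.1 hst ht.2
  have hd : ∀ s ∈ Set.uIcc a b, ∀ t ∈ Set.uIcc a b,
      dist (f s) (f t) ≤ dist (∫ r in a..s, h r) (∫ r in a..t, h r) :=
    fun s hs t ht => dist_le_dist_intervalIntegral hh hs ht H'
  have hac : AbsolutelyContinuousOnInterval f a b :=
    absolutelyContinuousOnInterval_of_dist_le
      (hh.absolutelyContinuousOnInterval_intervalIntegral (c := a) Set.left_mem_uIcc) hd
  have hdiff := hac.boundedVariationOn.ae_differentiableAt_of_mem_uIcc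
  have hbound : ∀ᵐ t, t ∈ Set.Icc a b → ‖deriv f t‖ ≤ ‖h t‖ := by
    have ha : ∀ᵐ x : ℝ, x ≠ a := by simp [ae_iff, measure_singleton]
    have hb : ∀ᵐ x : ℝ, x ≠ b := by simp [ae_iff, measure_singleton]
    filter_upwards [hdiff, hh.ae_hasDerivAt_integral, ha, hb] with t h1 h2 h3 h4 ht
    have ht' : t ∈ Set.uIcc a b := by rwa [Set.uIcc_of_le hab]
    refine norm_deriv_le_of_dist_le (h1 ht').hasDerivAt (h2 ht' a Set.left_mem_uIcc) ?_
    have : Set.Icc a b ∈ nhds t :=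
      Icc_mem_nhds (lt_of_le_of_ne ht.1 (Ne.symm h3)) (lt_of_le_of_ne ht.2 h4)
    filter_upwards [this] with r hr
    exact hd r (by rwa [Set.uIcc_of_le hab]) t ht'
  have hint : IntervalIntegrable (deriv f) volume a b := by
    refine hh.norm.mono_fun' (aestronglyMeasurable_deriv f _) ?_
    rw [Set.uIoc_of_le hab]
    filter_upwards [ae_restrict_of_ae hbound, ae_restrict_mem measurableSet_Ioc] with t ht htm
    exact ht (Set.Ioc_subset_Icc_self htm)
  refine ⟨hint, hbound, fun s hs t ht => ?_⟩
  have hst : Set.uIcc s t ⊆ Set.uIcc a b := by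
    rw [Set.uIcc_of_le hab]; exact Set.uIcc_subset_Icc hs ht
  refine (integral_eq_sub_of_ae_hasDerivAt (hac.mono hst) (hint.mono_set hst) ?_).symm
  filter_upwards [hdiff] with x hx hxm
  exact (hx (hst hxm)).hasDerivAt

/-- Integration by parts for a smooth scalar factor and a primitive. -/
theorem integral_smul_deriv_of_primitive [CompleteSpace F] {ψ g : ℝ → F} {θ θ' : ℝ → ℝ} {a b : ℝ}
    (hg : IntervalIntegrable g volume a b)
    (hψ : ∀ t, ψ t - ψ a = ∫ r in a..t, g r)
    (hθ : ∀ t, HasDerivAt θ (θ' t) t) (hθ' : Continuous θ') :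
    ∫ t in a..b, θ t • g t = θ b • ψ b - θ a • ψ a - ∫ t in a..b, θ' t • ψ t := by
  have hac : AbsolutelyContinuousOnInterval ψ a b :=
    absolutelyContinuousOnInterval_of_dist_le (absolutelyContinuousOnInterval_intervalIntegral hg)
      fun s _ t _ => by simp only [← hψ s, ← hψ t, dist_sub_right, le_refl]
  have hθc : Continuous θ := continuous_iff_continuousAt.2 fun t => (hθ t).continuousAt
  have hθac : AbsolutelyContinuousOnInterval θ a b := by
    refine ContDiffOn.absolutelyContinuousOnInterval (ContDiff.contDiffOn ?_)
    rw [contDiff_one_iff_deriv]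
    refine ⟨fun t => (hθ t).differentiableAt, ?_⟩
    have : deriv θ = θ' := funext fun t => (hθ t).deriv
    rwa [this]
  have i1 : IntervalIntegrable (fun t => θ t • g t) volume a b :=
    hg.continuousOn_smul hθc.continuousOn
  have i2 : IntervalIntegrable (fun t => θ' t • ψ t) volume a b :=
    (hθ'.continuousOn.smul hac.continuousOn).intervalIntegrable
  have := integral_eq_sub_of_ae_hasDerivAt (hθac.smul hac) (i1.add i2) (by
    filter_upwards [hg.ae_hasDerivAt_integral] with x hx hxm
    have hx1 := hx hxm a Set.left_mem_uIcc
    have hx2 : HasDerivAt ψ (g x) x := by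
      have : ψ = fun t => (∫ r in a..t, g r) + ψ a := funext fun t => by rw [← hψ t]; abel
      rw [this]
      exact hx1.add_const _
    exact (hθ x).smul hx2)
  simp only [Pi.smul_apply'] at this
  rw [intervalIntegral.integral_add i1 i2] at this
  rw [← this]; abel

end AbsolutelyContinuous

/-! ### Primitives and weak derivatives on the circle -/

section Circle

theorem coe_add_two_pi (t : ℝ) : ((t + 2 * Real.pi : ℝ) : S1) = (t : S1) :=
  AddCircle.coe_add_period _ _

theorem integral_circle {F : Type*} [NormedAddCommGroup F] [NormedSpace ℝ F] (f : S1 → F) (a : ℝ) :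
    ∫ s : S1, f s = ∫ t in a..a + 2 * Real.pi, f (t : S1) :=
  (AddCircle.intervalIntegral_preimage (2 * Real.pi) a f).symm

theorem ae_coe_of_ae {P : S1 → Prop} (h : ∀ᵐ s : S1, P s) : ∀ᵐ t : ℝ, P (t : S1) := by
  have h1 : ∀ m : ℤ, ∀ᵐ t : ℝ ∂volume.restrict
      (Set.Ioc (0 + m • (2 * Real.pi)) (0 + (m + 1) • (2 * Real.pi))), P (t : S1) := by
    intro m
    have := (AddCircle.measurePreserving_mk (2 * Real.pi) (0 + m • (2 * Real.pi))).quasiMeasurePreserving.ae h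
    rw [add_smul, one_smul, ← add_assoc]
    exact this
  rw [← ae_restrict_iUnion_iff, iUnion_Ioc_add_zsmul Real.two_pi_pos 0, Measure.restrict_univ] at h1
  exact h1

theorem ae_of_ae_coe {P : S1 → Prop} (h : ∀ᵐ t : ℝ, P (t : S1)) : ∀ᵐ s : S1, P s := by
  have h1 := (AddCircle.measurePreserving_equivIoc (2 * Real.pi) (a := 0)).quasiMeasurePreserving.ae
    (p := fun y => P ((y : ℝ) : S1)) (by
      have : ∀ᵐ t : ℝ ∂volume.restrict (Set.Ioc 0 (0 + 2 * Real.pi)), P (t : S1) :=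
        ae_restrict_of_ae h
      exact (ae_restrict_iff_subtype measurableSet_Ioc).1 this)
  filter_upwards [h1] with s hs
  have := (AddCircle.equivIoc (2 * Real.pi) 0).symm_apply_apply s
  rw [← this]
  exact hs

theorem intervalIntegrable_coe {F : Type*} [NormedAddCommGroup F] {g : S1 → F}
    (hg : Integrable g) (a b : ℝ) : IntervalIntegrable (fun t : ℝ => g (t : S1)) volume a b := by
  have hp : Function.Periodic (fun t : ℝ => g (t : S1)) (2 * Real.pi) := fun t => by
    simp only [coe_add_two_pi]
  refine hp.intervalIntegrable Real.two_pi_pos.ne' (t := 0) ?_ a b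
  rw [intervalIntegrable_iff_integrableOn_Ioc_of_le (by linarith [Real.two_pi_pos])]
  exact (AddCircle.measurePreserving_mk (2 * Real.pi) 0).integrable_comp_of_integrable hg

theorem ae_hasDerivAt_integral_coe {n : ℕ} {g : S1 → E n} (hg : Integrable g) :
    ∀ᵐ t : ℝ, ∀ c : ℝ, HasDerivAt (fun x : ℝ => ∫ r in c..x, g (r : S1)) (g (t : S1)) t := by
  refine LocallyIntegrable.ae_hasDerivAt_integral fun x => ⟨Set.Icc (x - 1) (x + 1),
    Icc_mem_nhds (by linarith) (by linarith), ?_⟩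
  exact (intervalIntegrable_iff_integrableOn_Icc_of_le (by linarith)).1
    (intervalIntegrable_coe hg _ _)

/-- `g` is a weak derivative of `u` on the circle. -/
def IsPrimitive {n : ℕ} (u g : S1 → E n) : Prop :=
  ∀ a b : ℝ, u (b : S1) - u (a : S1) = ∫ t in a..b, g (t : S1)

variable {n : ℕ} {u v g γ : S1 → E n}

theorem IsPrimitive.ae_hasDerivAt (h : IsPrimitive u g) (hg : Integrable g) :
    ∀ᵐ t : ℝ, HasDerivAt (fun r : ℝ => u (r : S1)) (g (t : S1)) t := by
  filter_upwards [ae_hasDerivAt_integral_coe hg] with t ht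
  have : (fun r : ℝ => u (r : S1)) = fun r => (∫ s in (0 : ℝ)..r, g (s : S1)) + u ((0 : ℝ) : S1) :=
    funext fun r => by rw [← h 0 r]; abel
  rw [this]
  exact (ht 0).add_const _

theorem circleDeriv_coe (u : S1 → E n) (t : ℝ) :
    circleDeriv u (t : S1) = deriv (fun r : ℝ => u (r : S1)) t := by
  have := deriv_comp_const_add (f := fun r : ℝ => u (r : S1)) t 0
  rw [add_zero] at this
  rw [← this, circleDeriv]
  simp only [AddCircle.coe_add]

theorem IsPrimitive.circleDeriv_ae (h : IsPrimitive u g) (hg : Integrable g) :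
    circleDeriv u =ᵐ[volume] g := by
  refine ae_of_ae_coe (P := fun s => circleDeriv u s = g s) ?_
  filter_upwards [h.ae_hasDerivAt hg] with t ht
  rw [circleDeriv_coe, ht.deriv]

theorem IsPrimitive.energy_eq (h : IsPrimitive u g) (hg : Integrable g) :
    energy u = ∫ s, ‖g s‖ ^ 2 := by
  refine integral_congr_ae ?_
  filter_upwards [h.circleDeriv_ae hg] with s hs
  rw [hs]

theorem continuous_of_continuous_coe {X : Type*} [TopologicalSpace X] {f : S1 → X}
    (h : Continuous fun t : ℝ => f (t : S1)) : Continuous f :=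
  QuotientAddGroup.isOpenQuotientMap_mk.isQuotientMap.continuous_iff.2 h

theorem IsPrimitive.continuous (h : IsPrimitive u g) (hg : Integrable g) : Continuous u := by
  refine continuous_of_continuous_coe ?_
  have : (fun r : ℝ => u (r : S1)) = fun r => (∫ s in (0 : ℝ)..r, g (s : S1)) + u ((0 : ℝ) : S1) :=
    funext fun r => by rw [← h 0 r]; abel
  rw [this]
  exact (intervalIntegral.continuous_primitive (intervalIntegrable_coe hg) 0).add_const _

theorem IsPrimitive.congr (h : IsPrimitive u g) (hγ : g =ᵐ[volume] γ) : IsPrimitive u γ := by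
  intro a b
  rw [h a b]
  refine intervalIntegral.integral_congr_ae ?_
  filter_upwards [ae_coe_of_ae hγ] with t ht _
  exact ht

theorem IsPrimitive.add (hu : IsPrimitive u g) (hv : IsPrimitive v γ) (hg : Integrable g)
    (hγ : Integrable γ) : IsPrimitive (u + v) (g + γ) := by
  intro a b
  simp only [Pi.add_apply]
  rw [intervalIntegral.integral_add (intervalIntegrable_coe hg _ _) (intervalIntegrable_coe hγ _ _),
    ← hu, ← hv]
  abel

theorem IsPrimitive.const_smul (hu : IsPrimitive u g) (c : ℝ) : IsPrimitive (c • u) (c • g) := by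
  intro a b
  simp only [Pi.smul_apply]
  rw [intervalIntegral.integral_smul, ← hu, smul_sub]

/-- Zero mean makes the primitive on the line 2π-periodic, so it descends to the circle. -/
theorem exists_isPrimitive (hg : Integrable g) (h0 : ∫ s, g s = 0) (a : ℝ) (c : E n) :
    ∃ u : S1 → E n, u (a : S1) = c ∧ IsPrimitive u g := by
  have hi := intervalIntegrable_coe hg
  have hper : Function.Periodic (fun t : ℝ => c + ∫ r in a..t, g (r : S1)) (2 * Real.pi) := by
    intro t
    have h1 := intervalIntegral.integral_add_adjacent_intervals (hi a t) (hi t (t + 2 * Real.pi))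
    rw [← integral_circle g t, h0, add_zero] at h1
    simp only [h1]
  refine ⟨hper.lift, ?_, fun s t => ?_⟩
  · rw [Function.Periodic.lift_coe]; simp
  · rw [Function.Periodic.lift_coe, Function.Periodic.lift_coe, add_sub_add_left_eq_sub,
      intervalIntegral.integral_interval_sub_left (hi _ _) (hi _ _)]

theorem IsPrimitive.integral_eq_zero (h : IsPrimitive u g) : ∫ s, g s = 0 := by
  rw [integral_circle g 0, ← h, coe_add_two_pi, sub_self]

theorem memLp_two_integrable (hg : MemLp g 2 volume) : Integrable g :=
  hg.integrable (by norm_num)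

theorem MemW12.continuous (h : MemW12 u) : Continuous u := by
  obtain ⟨g, hg, hu⟩ := h
  exact IsPrimitive.continuous hu (memLp_two_integrable hg)

/-- A Lipschitz function on the circle is a primitive of its derivative. -/
theorem isPrimitive_circleDeriv_of_lipschitz {K : NNReal} (h : LipschitzWith K u) :
    IsPrimitive u (circleDeriv u) := by
  have hlip : ∀ s t : ℝ, s ≤ t → ‖u (t : S1) - u (s : S1)‖ ≤ ∫ _r in s..t, (K : ℝ) := by
    intro s t hst
    rw [intervalIntegral.integral_const, ← dist_eq_norm, smul_eq_mul]
    refine ((h.dist_le_mul _ _).trans (mul_le_mul_of_nonneg_left ?_ K.2)).trans_eq (mul_comm _ _)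
    rw [dist_eq_norm, ← AddCircle.coe_sub]
    refine (QuotientAddGroup.norm_mk_le_norm).trans ?_
    rw [Real.norm_eq_abs, abs_of_nonneg (by linarith)]
  have key : ∀ a b : ℝ, a ≤ b →
      u (b : S1) - u (a : S1) = ∫ t in a..b, circleDeriv u (t : S1) := by
    intro a b hab
    simp only [circleDeriv_coe]
    exact (ftc_of_norm_sub_le (f := fun t : ℝ => u (t : S1)) hab
      intervalIntegrable_const fun s t _ hst _ => hlip s t hst).2.2 a ⟨le_rfl, hab⟩ b ⟨hab, le_rfl⟩
  intro a b
  rcases le_total a b with hab | hab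
  · exact key a b hab
  · rw [intervalIntegral.integral_symm, ← key b a hab]; abel

theorem IsPrimitive.lipschitz {K : NNReal} (h : IsPrimitive u g) (hK : ∀ s, ‖g s‖ ≤ K) :
    LipschitzWith K u := by
  refine LipschitzWith.of_dist_le_mul fun x y => ?_
  -- Take the shortest lift of x - y, so that the interval of integration has length equal to the
  -- circle distance.
  obtain ⟨d, hd, hdn⟩ : ∃ d : ℝ, ((d : ℝ) : S1) = x - y ∧ |d| = dist x y := by
    obtain ⟨r, hr⟩ := QuotientAddGroup.mk_surjective (x - y)
    refine ⟨r - round ((2 * Real.pi)⁻¹ * r) * (2 * Real.pi), ?_, ?_⟩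
    · rw [← hr, ← zsmul_eq_mul, AddCircle.coe_sub, AddCircle.coe_zsmul, AddCircle.coe_period,
        smul_zero, sub_zero]
    · rw [dist_eq_norm, ← hr]
      exact (AddCircle.norm_eq (2 * Real.pi)).symm
  obtain ⟨t, rfl⟩ := QuotientAddGroup.mk_surjective y
  have hx : x = ((t + d : ℝ) : S1) := by
    rw [AddCircle.coe_add, hd]; abel
  rw [← hdn, dist_eq_norm, hx]
  refine (le_of_eq (congrArg norm (h t (t + d)))).trans ?_
  have := intervalIntegral.norm_integral_le_of_norm_le_const (a := t) (b := t + d)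
    (f := fun r : ℝ => g (r : S1)) (C := K) fun r _ => hK _
  simpa using this

end Circle

/-! ### The direction map sgn and the zero set -/

section Sgn

variable {n : ℕ}

theorem sgn_zero : sgn (0 : E n) = 0 := smul_zero _

theorem norm_sgn {v : E n} (hv : v ≠ 0) : ‖sgn v‖ = 1 := norm_smul_inv_norm hv

theorem norm_sgn_le (v : E n) : ‖sgn v‖ ≤ 1 := by
  rcases eq_or_ne v 0 with rfl | hv
  · rw [sgn_zero, norm_zero]; exact zero_le_one
  · exact (norm_sgn hv).le

theorem norm_smul_sgn (v : E n) : ‖v‖ • sgn v = v := by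
  rcases eq_or_ne v 0 with rfl | hv
  · rw [norm_zero, zero_smul]
  · rw [sgn, smul_smul, mul_inv_cancel₀ (norm_ne_zero_iff.2 hv), one_smul]

theorem sgn_smul {c : ℝ} (hc : 0 < c) (v : E n) : sgn (c • v) = sgn v := by
  rw [sgn, sgn, norm_smul, Real.norm_of_nonneg hc.le, smul_smul, mul_inv, mul_right_comm,
    inv_mul_cancel₀ hc.ne', one_mul]

theorem continuousAt_sgn {v : E n} (hv : v ≠ 0) : ContinuousAt sgn v :=
  (continuousAt_id.norm.inv₀ (norm_ne_zero_iff.2 hv)).smul continuousAt_id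

theorem measurable_sgn : Measurable (sgn : E n → E n) :=
  (measurable_norm.inv).smul measurable_id

theorem integrable_of_norm_le_one {f : S1 → E n} (hf : AEStronglyMeasurable f volume)
    (h : ∀ s, ‖f s‖ ≤ 1) : Integrable f :=
  Integrable.of_bound hf 1 (Filter.Eventually.of_forall h)

theorem integrable_sgn {ψ : S1 → E n} (hψ : Continuous ψ) : Integrable fun s => sgn (ψ s) :=
  integrable_of_norm_le_one (measurable_sgn.comp hψ.measurable).aestronglyMeasurable
    fun _ => norm_sgn_le _

theorem isClosed_zeroSet {ψ : S1 → E n} (hψ : Continuous ψ) : IsClosed (zeroSet ψ) :=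
  isClosed_eq hψ continuous_const

theorem measurableSet_zeroSet {ψ : S1 → E n} (hψ : Continuous ψ) : MeasurableSet (zeroSet ψ) :=
  (isClosed_zeroSet hψ).measurableSet

theorem norm_integral_le_measureReal {f : S1 → E n} {A : Set S1} (hA : MeasurableSet A)
    (h1 : ∀ s, ‖f s‖ ≤ 1) (h0 : ∀ s, s ∉ A → f s = 0) : ‖∫ s, f s‖ ≤ volume.real A := by
  have : f = A.indicator f := by
    ext1 s
    by_cases hs : s ∈ A
    · rw [Set.indicator_of_mem hs]
    · rw [Set.indicator_of_notMem hs, h0 s hs]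
  rw [this, integral_indicator hA]
  refine (norm_setIntegral_le_of_norm_le_const (measure_lt_top _ _) fun s _ => h1 s).trans ?_
  rw [one_mul]

/-- Replacing `ψ` by zero on a part of the circle preserves the slack in the weak loop condition. -/
theorem norm_integral_sgn_le_of_eq_or_eq_zero {ψ χ : S1 → E n} (hψ : Continuous ψ)
    (hχ : Continuous χ) (h : ∀ s, χ s = ψ s ∨ χ s = 0) :
    ‖∫ s, sgn (χ s)‖ ≤ ‖∫ s, sgn (ψ s)‖ + (volume.real (zeroSet χ) - volume.real (zeroSet ψ)) := by
  have hsub : zeroSet ψ ⊆ zeroSet χ := fun s hs => by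
    rcases h s with h1 | h1
    · exact h1.trans hs
    · exact h1
  rw [← measureReal_sdiff hsub (measurableSet_zeroSet hψ)]
  -- The removed part has norm at most 1 and lives on Z[χ] \ Z[ψ], exactly the set by which the zero
  -- set grows.
  have h1 : ∫ s, sgn (χ s) = (∫ s, sgn (ψ s)) - ∫ s, (sgn (ψ s) - sgn (χ s)) := by
    rw [integral_sub (integrable_sgn hψ) (integrable_sgn hχ)]; abel
  rw [h1]
  refine (norm_sub_le _ _).trans (add_le_add_right ?_ _)
  refine norm_integral_le_measureReal
    ((measurableSet_zeroSet hχ).diff (measurableSet_zeroSet hψ)) (fun s => ?_) fun s hs => ?_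
  · rcases h s with h2 | h2
    · rw [h2, sub_self, norm_zero]; exact zero_le_one
    · rw [h2, sgn_zero, sub_zero]; exact norm_sgn_le _
  · rcases h s with h2 | h2
    · rw [h2, sub_self]
    · have : ψ s = 0 := by
        by_contra h3
        exact hs ⟨h2, h3⟩
      rw [h2, this, sub_self]

end Sgn

/-! ### Arcs of the circle: complements, integrals, lengths -/

section Arc

theorem coe_inj_of_mem_Ioc {a s t : ℝ} (hs : s ∈ Set.Ioc a (a + 2 * Real.pi))
    (ht : t ∈ Set.Ioc a (a + 2 * Real.pi)) (h : (s : S1) = (t : S1)) : s = t :=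
  (AddCircle.coe_eq_coe_iff_of_mem_Ioc hs ht).1 h

theorem exists_coe_mem_Ioc (a : ℝ) (s : S1) :
    ∃ t ∈ Set.Ioc a (a + 2 * Real.pi), (t : S1) = s :=
  ⟨AddCircle.equivIoc (2 * Real.pi) a s, (AddCircle.equivIoc (2 * Real.pi) a s).2,
    (AddCircle.equivIoc (2 * Real.pi) a).symm_apply_apply s⟩

theorem coe_mem_openArc_iff {a b t : ℝ} (hb : b ≤ a + 2 * Real.pi)
    (ht : t ∈ Set.Ioc a (a + 2 * Real.pi)) : (t : S1) ∈ openArc a b ↔ t < b := by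
  constructor
  · rintro ⟨s, hs, hst⟩
    rw [← coe_inj_of_mem_Ioc ⟨hs.1, hs.2.le.trans hb⟩ ht hst]
    exact hs.2
  · exact fun h => ⟨t, ⟨ht.1, h⟩, rfl⟩

theorem compl_openArc {a b : ℝ} (hab : a < b) (hb : b ≤ a + 2 * Real.pi) :
    (openArc a b)ᶜ = arc b (a + 2 * Real.pi) := by
  ext s
  obtain ⟨t, ht, rfl⟩ := exists_coe_mem_Ioc a s
  rw [Set.mem_compl_iff, coe_mem_openArc_iff hb ht, not_lt]
  constructor
  · exact fun h => ⟨t, ⟨h, ht.2⟩, rfl⟩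
  · rintro ⟨r, hr, hrt⟩
    rw [← coe_inj_of_mem_Ioc ⟨hab.trans_le hr.1, hr.2⟩ ht hrt]
    exact hr.1

theorem isOpen_openArc (a b : ℝ) : IsOpen (openArc a b) :=
  QuotientAddGroup.isOpenMap_coe _ isOpen_Ioo

theorem measurableSet_openArc (a b : ℝ) : MeasurableSet (openArc a b) :=
  (isOpen_openArc a b).measurableSet

theorem setIntegral_openArc {F : Type*} [NormedAddCommGroup F] [NormedSpace ℝ F] (f : S1 → F)
    {a b : ℝ} (hab : a ≤ b) (hb : b ≤ a + 2 * Real.pi) :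
    ∫ s in openArc a b, f s = ∫ t in a..b, f (t : S1) := by
  rw [← integral_indicator (measurableSet_openArc a b),
    ← AddCircle.integral_preimage (2 * Real.pi) a, intervalIntegral.integral_of_le hab]
  have : ∫ t in Set.Ioc a (a + 2 * Real.pi), (openArc a b).indicator f (t : S1) =
      ∫ t in Set.Ioc a (a + 2 * Real.pi), (Set.Ioo a b).indicator (fun t : ℝ => f (t : S1)) t := by
    refine setIntegral_congr_fun measurableSet_Ioc fun t ht => ?_
    simp only [Set.indicator, coe_mem_openArc_iff hb ht, Set.mem_Ioo, ht.1, true_and]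
  rw [this, setIntegral_indicator measurableSet_Ioo,
    integral_Ioc_eq_integral_Ioo, Set.inter_eq_self_of_subset_right
      (show Set.Ioo a b ⊆ Set.Ioc a (a + 2 * Real.pi) from
        fun t ht => ⟨ht.1, ht.2.le.trans hb⟩)]

theorem integral_of_eq_zero_off_openArc {F : Type*} [NormedAddCommGroup F] [NormedSpace ℝ F]
    {f : S1 → F} {a b : ℝ} (hab : a ≤ b) (hb : b ≤ a + 2 * Real.pi)
    (h : ∀ s, s ∉ openArc a b → f s = 0) : ∫ s, f s = ∫ t in a..b, f (t : S1) := by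
  rw [← setIntegral_openArc f hab hb]
  exact (setIntegral_eq_integral_of_forall_compl_eq_zero fun s hs => h s hs).symm

theorem measureReal_openArc {a b : ℝ} (hab : a ≤ b) (hb : b ≤ a + 2 * Real.pi) :
    volume.real (openArc a b) = b - a := by
  have := setIntegral_openArc (fun _ => (1 : ℝ)) hab hb
  simpa using this

theorem measureReal_univ_circle : volume.real (Set.univ : Set S1) = 2 * Real.pi := by
  rw [Measure.real, AddCircle.measure_univ, ENNReal.toReal_ofReal Real.two_pi_pos.le]

theorem measureReal_compl_openArc {a b : ℝ} (hab : a ≤ b) (hb : b ≤ a + 2 * Real.pi) :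
    volume.real (openArc a b)ᶜ = 2 * Real.pi - (b - a) := by
  rw [measureReal_compl (measurableSet_openArc a b), measureReal_univ_circle,
    measureReal_openArc hab hb]

end Arc

/-! ### Scaling, and restriction of a minimizer to one block -/

section Minimizer

variable {n : ℕ} {ψ χ : S1 → E n}

theorem MemW12.const_smul (h : MemW12 ψ) (c : ℝ) : MemW12 (c • ψ) := by
  obtain ⟨g, hg, hu⟩ := h
  exact ⟨c • g, hg.const_smul c, IsPrimitive.const_smul hu c⟩

theorem energy_smul (h : MemW12 ψ) (c : ℝ) : energy (c • ψ) = c ^ 2 * energy ψ := by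
  obtain ⟨g, hg, hu⟩ := h
  rw [IsPrimitive.energy_eq (IsPrimitive.const_smul hu c)
    (memLp_two_integrable (hg.const_smul c)), IsPrimitive.energy_eq hu (memLp_two_integrable hg),
    ← integral_const_mul]
  simp only [Pi.smul_apply, norm_smul, mul_pow, Real.norm_eq_abs, sq_abs]

theorem energy_nonneg (ψ : S1 → E n) : 0 ≤ energy ψ := integral_nonneg fun _ => by positivity

theorem zeroSet_smul {c : ℝ} (hc : c ≠ 0) : zeroSet (c • ψ) = zeroSet ψ := by
  ext s
  simp [zeroSet, hc]

theorem admissible_smul (hχ : MemW12 χ)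
    (hloop : ‖∫ s : S1, sgn (χ s)‖ ≤ volume.real (zeroSet χ)) (hm : 0 < ∫ s, ‖χ s‖ ^ 2) :
    Admissible ((√(∫ s, ‖χ s‖ ^ 2))⁻¹ • χ) := by
  have hc : 0 < (√(∫ s, ‖χ s‖ ^ 2))⁻¹ := inv_pos.2 (Real.sqrt_pos.2 hm)
  refine ⟨hχ.const_smul _, ?_, ?_⟩
  · simp only [Pi.smul_apply, norm_smul, mul_pow]
    rw [integral_const_mul, Real.norm_eq_abs, sq_abs, inv_pow, Real.sq_sqrt hm.le,
      inv_mul_cancel₀ hm.ne']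
  · rw [zeroSet_smul hc.ne']
    simpa only [Pi.smul_apply, sgn_smul hc] using hloop

/-- Minimality in homogeneous (Rayleigh quotient) form, which spares competitors the normalization.
-/
theorem IsMinimizer.mul_le_energy (hψ : IsMinimizer ψ) (hχ : MemW12 χ)
    (hloop : ‖∫ s : S1, sgn (χ s)‖ ≤ volume.real (zeroSet χ)) :
    energy ψ * ∫ s, ‖χ s‖ ^ 2 ≤ energy χ := by
  have h0 : 0 ≤ ∫ s, ‖χ s‖ ^ 2 := integral_nonneg fun _ => by positivity
  rcases h0.eq_or_lt with hm | hm
  · rw [← hm, mul_zero]; exact energy_nonneg χ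
  · have := hψ.2 _ (admissible_smul hχ hloop hm)
    rw [energy_smul hχ, inv_pow, Real.sq_sqrt hm.le] at this
    rwa [← div_eq_inv_mul, le_div_iff₀ hm] at this

/-- The open arc from `a` to `b` is a component of the complement of the zero set. -/
structure IsBlock (ψ : S1 → E n) (a b : ℝ) : Prop where
  lt : a < b
  le : b ≤ a + 2 * Real.pi
  left : ψ (a : S1) = 0
  right : ψ (b : S1) = 0
  ne_zero : ∀ t ∈ Set.Ioo a b, ψ (t : S1) ≠ 0

/-- Since ψ vanishes at both ends of the block, truncation creates no jump, and the truncated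
derivative has zero mean. -/
theorem IsBlock.exists_restriction {a b : ℝ} {g : S1 → E n} (hg : MemLp g 2 volume)
    (hψ : IsPrimitive ψ g) (h : IsBlock ψ a b) :
    ∃ χ, IsPrimitive χ ((openArc a b).indicator g) ∧ χ = (openArc a b).indicator ψ := by
  have hgi := memLp_two_integrable hg
  have hγi : Integrable ((openArc a b).indicator g) := hgi.indicator (measurableSet_openArc a b)
  have hint : ∀ t ∈ Set.Icc a b,
      ∫ r in a..t, (openArc a b).indicator g (r : S1) = ψ (t : S1) - ψ (a : S1) := by
    intro t ht
    rw [hψ a t]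
    have hne : ∀ᵐ r : ℝ, r ≠ b := by simp [ae_iff, measure_singleton]
    refine intervalIntegral.integral_congr_ae ?_
    filter_upwards [hne] with r hrb hr
    rw [Set.uIoc_of_le ht.1] at hr
    rw [Set.indicator_of_mem]
    exact ⟨r, ⟨hr.1, lt_of_le_of_ne (hr.2.trans ht.2) hrb⟩, rfl⟩
  have h0 : ∫ s, (openArc a b).indicator g s = 0 := by
    rw [integral_of_eq_zero_off_openArc h.lt.le h.le fun s hs => Set.indicator_of_notMem hs _,
      hint b ⟨h.lt.le, le_rfl⟩, h.left, h.right, sub_self]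
  obtain ⟨χ, hχa, hχ⟩ := exists_isPrimitive hγi h0 a (0 : E n)
  refine ⟨χ, hχ, funext fun s => ?_⟩
  obtain ⟨t, ht, rfl⟩ := exists_coe_mem_Ioc a s
  have hle : ∀ t ∈ Set.Icc a b, χ (t : S1) = ψ (t : S1) := fun t ht => by
    have := hχ a t
    rw [hint t ht, hχa, h.left, sub_zero, sub_zero] at this
    exact this
  by_cases htb : t < b
  · rw [Set.indicator_of_mem ((coe_mem_openArc_iff h.le ht).2 htb)]
    exact hle t ⟨ht.1.le, htb.le⟩
  · rw [Set.indicator_of_notMem (fun hm => htb ((coe_mem_openArc_iff h.le ht).1 hm))]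
    have h1 := hχ b t
    rw [hle b ⟨h.lt.le, le_rfl⟩, h.right, sub_zero] at h1
    rw [h1, intervalIntegral.integral_of_le (not_lt.1 htb)]
    refine setIntegral_eq_zero_of_forall_eq_zero fun r hr => Set.indicator_of_notMem ?_ _
    rw [coe_mem_openArc_iff h.le ⟨h.lt.trans hr.1, hr.2.trans ht.2⟩]
    exact not_lt.2 hr.1.le

theorem integral_norm_sq_indicator_add {f : S1 → E n} (hf : MemLp f 2 volume) {A : Set S1}
    (hA : MeasurableSet A) :
    (∫ s, ‖A.indicator f s‖ ^ 2) + ∫ s, ‖Aᶜ.indicator f s‖ ^ 2 = ∫ s, ‖f s‖ ^ 2 := by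
  rw [← integral_add ((hf.indicator hA).integrable_norm_pow (by norm_num))
    ((hf.indicator hA.compl).integrable_norm_pow (by norm_num))]
  congr 1
  ext s
  by_cases hs : s ∈ A <;> simp [hs]

theorem memLp_of_continuous (h : Continuous ψ) : MemLp ψ 2 volume :=
  h.memLp_of_hasCompactSupport (HasCompactSupport.of_compactSpace ψ)

/-- The restriction of a minimizer to a single block is, after normalization, a minimizer. -/
theorem IsMinimizer.exists_isMinimizer_block {a b : ℝ} (hψ : IsMinimizer ψ) (h : IsBlock ψ a b) :
    ∃ χ, IsMinimizer χ ∧ energy χ = energy ψ ∧ zeroSet χ = (openArc a b)ᶜ ∧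
      ∀ s ∈ openArc a b, sgn (χ s) = sgn (ψ s) := by
  have hW := hψ.1.memW12
  have hc := hW.continuous
  obtain ⟨g, hg, hu⟩ := hW
  obtain ⟨χ, hχ, hχe⟩ := h.exists_restriction hg hu
  set A := openArc a b with hAdef
  have hA : MeasurableSet A := measurableSet_openArc a b
  have hχW : MemW12 χ := ⟨_, hg.indicator hA, hχ⟩
  have hχc : Continuous χ := hχW.continuous
  have hu' : IsPrimitive (Aᶜ.indicator ψ) (Aᶜ.indicator g) := by
    have := IsPrimitive.add hu (hχ.const_smul (-1)) (memLp_two_integrable hg)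
      ((memLp_two_integrable (hg.indicator hA)).smul (-1 : ℝ))
    convert this using 1
    · rw [Set.indicator_compl, ← hχe, sub_eq_add_neg, neg_one_smul]
    · rw [Set.indicator_compl, sub_eq_add_neg, neg_one_smul]
  have hW' : MemW12 (Aᶜ.indicator ψ) := ⟨_, hg.indicator hA.compl, hu'⟩
  have loop : ∀ χ : S1 → E n, Continuous χ → (∀ s, χ s = ψ s ∨ χ s = 0) →
      ‖∫ s : S1, sgn (χ s)‖ ≤ volume.real (zeroSet χ) := fun χ hχ hχ' => by
    have := norm_integral_sgn_le_of_eq_or_eq_zero hc hχ hχ'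
    linarith [hψ.1.weakLoop]
  have loop1 := loop χ hχc fun s => by rw [hχe]; exact (Set.indicator_eq_zero_or_self A ψ s).symm
  have loop2 := loop _ hW'.continuous fun s => (Set.indicator_eq_zero_or_self Aᶜ ψ s).symm
  have e1 := hψ.mul_le_energy hχW loop1
  have e2 := hψ.mul_le_energy hW' loop2
  have hsum := integral_norm_sq_indicator_add hg hA
  have hsum' := integral_norm_sq_indicator_add (memLp_of_continuous hc) hA
  rw [← hχ.energy_eq (memLp_two_integrable (hg.indicator hA)),
    ← hu'.energy_eq (memLp_two_integrable (hg.indicator hA.compl)),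
    ← IsPrimitive.energy_eq hu (memLp_two_integrable hg)] at hsum
  rw [← hχe, hψ.1.normalized] at hsum'
  -- `e1` and `e2` bound the energies of the two pieces from below, and both energies and masses add
  -- up to those of ψ. So neither inequality can be strict.
  have hE : energy χ = energy ψ * ∫ s, ‖χ s‖ ^ 2 := by
    refine le_antisymm ?_ e1
    have : energy ψ = energy ψ * 1 := (mul_one _).symm
    rw [← hsum', mul_add] at this
    linarith
  have hmem : ∀ s, s ∈ A ↔ χ s ≠ 0 := by
    intro s
    constructor
    · rintro ⟨t, ht, rfl⟩
      rw [hχe, Set.indicator_of_mem (show (t : S1) ∈ A from ⟨t, ht, rfl⟩)]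
      exact h.ne_zero t ht
    · intro hs
      by_contra hsA
      exact hs (by rw [hχe, Set.indicator_of_notMem hsA])
  have hm : 0 < ∫ s, ‖χ s‖ ^ 2 := by
    have hm0 : (((a + b) / 2 : ℝ) : S1) ∈ A :=
      ⟨_, ⟨by linarith [h.lt], by linarith [h.lt]⟩, rfl⟩
    refine (hχc.norm.pow 2).integral_pos_of_hasCompactSupport_nonneg_nonzero
      (HasCompactSupport.of_compactSpace _) (fun s => by positivity)
      (x := (((a + b) / 2 : ℝ) : S1)) ?_
    exact pow_ne_zero 2 (norm_ne_zero_iff.2 ((hmem _).1 hm0))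
  have hcpos : 0 < (√(∫ s, ‖χ s‖ ^ 2))⁻¹ := inv_pos.2 (Real.sqrt_pos.2 hm)
  have hEn : energy ((√(∫ s, ‖χ s‖ ^ 2))⁻¹ • χ) = energy ψ := by
    rw [energy_smul hχW, inv_pow, Real.sq_sqrt hm.le, hE]
    field_simp
  refine ⟨(√(∫ s, ‖χ s‖ ^ 2))⁻¹ • χ, ⟨admissible_smul hχW loop1 hm, fun η hη => ?_⟩, hEn, ?_, ?_⟩
  · rw [hEn]; exact hψ.2 η hη
  · rw [zeroSet_smul hcpos.ne']
    ext s
    rw [Set.mem_compl_iff, hmem, not_not]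
    rfl
  · intro s hs
    rw [Pi.smul_apply, sgn_smul hcpos, hχe, Set.indicator_of_mem hs]

end Minimizer

/-! ### First variation when the loop condition is slack -/

section Variation

variable {n : ℕ}

theorem integrable_inner_of_memLp {f h : S1 → E n} (hf : MemLp f 2 volume)
    (hh : MemLp h 2 volume) : Integrable fun s => inner ℝ (f s) (h s) := by
  refine (L2.integrable_inner (𝕜 := ℝ) (hf.toLp f) (hh.toLp h)).congr ?_
  filter_upwards [hf.coeFn_toLp, hh.coeFn_toLp] with s h1 h2
  rw [h1, h2]

theorem integral_norm_add_smul_sq {f h : S1 → E n} (hf : MemLp f 2 volume) (hh : MemLp h 2 volume)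
    (ε : ℝ) : ∫ s, ‖(f + ε • h) s‖ ^ 2 =
      (∫ s, ‖f s‖ ^ 2) + 2 * ε * (∫ s, inner ℝ (f s) (h s)) + ε ^ 2 * ∫ s, ‖h s‖ ^ 2 := by
  have i1 := hf.integrable_norm_pow (by norm_num)
  have i2 := hh.integrable_norm_pow (by norm_num)
  have i3 := integrable_inner_of_memLp hf hh
  have i4 : Integrable fun s => ‖f s‖ ^ 2 + 2 * ε * inner ℝ (f s) (h s) := i1.add (i3.const_mul _)
  rw [← integral_const_mul, ← integral_const_mul, ← integral_add i1 (i3.const_mul _),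
    ← integral_add i4 (i2.const_mul _)]
  congr 1
  ext s
  rw [Pi.add_apply, Pi.smul_apply, norm_add_sq_real, inner_smul_right, norm_smul, mul_pow,
    Real.norm_eq_abs, sq_abs]
  ring

/-- Dominated convergence: sgn is bounded by 1 and continuous away from 0. It is used for small
variations as well as for minimizing sequences. -/
theorem tendsto_integral_sgn {ι : Type*} {l : Filter ι} [l.IsCountablyGenerated] {ψ : S1 → E n}
    {χ : ι → S1 → E n} (hχ : ∀ i, Continuous (χ i)) {A : Set S1} (hA : MeasurableSet A)
    (hψ : ∀ s ∈ A, ψ s ≠ 0)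
    (h : ∀ s ∈ A, Filter.Tendsto (fun i => χ i s) l (nhds (ψ s))) :
    Filter.Tendsto (fun i => ∫ s in A, sgn (χ i s)) l (nhds (∫ s in A, sgn (ψ s))) := by
  refine tendsto_integral_filter_of_dominated_convergence (fun _ => (1 : ℝ)) ?_ ?_
    (integrable_const _) ?_
  · exact Filter.Eventually.of_forall fun i => (integrable_sgn (hχ i)).1.restrict
  · exact Filter.Eventually.of_forall fun i => Filter.Eventually.of_forall fun s => norm_sgn_le _
  · filter_upwards [ae_restrict_mem hA] with s hs
    exact (continuousAt_sgn (hψ s hs)).tendsto.comp (h s hs)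

theorem setIntegral_compl_zeroSet {ψ χ : S1 → E n} (h : ∀ s ∈ zeroSet ψ, χ s = 0) :
    ∫ s in (zeroSet ψ)ᶜ, sgn (χ s) = ∫ s, sgn (χ s) :=
  setIntegral_eq_integral_of_forall_compl_eq_zero fun s hs => by
    rw [h s (not_not.1 hs), sgn_zero]

/-- The Euler-Lagrange equation of a minimizer for which the weak loop condition is not active. -/
theorem IsMinimizer.integral_inner_eq {ψ g w γ : S1 → E n} (hψ : IsMinimizer ψ)
    (hg : MemLp g 2 volume) (hu : IsPrimitive ψ g)
    (hlt : ‖∫ s, sgn (ψ s)‖ < volume.real (zeroSet ψ))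
    (hγ : MemLp γ 2 volume) (hw : IsPrimitive w γ) (hw0 : ∀ s ∈ zeroSet ψ, w s = 0) :
    ∫ s, inner ℝ (g s) (γ s) = energy ψ * ∫ s, inner ℝ (ψ s) (w s) := by
  have hψc := hψ.1.memW12.continuous
  have hwc : Continuous w := hw.continuous (memLp_two_integrable hγ)
  have hsub : ∀ ε : ℝ, zeroSet ψ ⊆ zeroSet (ψ + ε • w) := fun ε s hs => by
    have h1 : ψ s = 0 := hs
    simp [zeroSet, h1, hw0 s hs]
  have hlim : Filter.Tendsto (fun ε : ℝ => ∫ s, sgn ((ψ + ε • w) s)) (nhds 0)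
      (nhds (∫ s, sgn (ψ s))) := by
    have := tendsto_integral_sgn (l := nhds (0 : ℝ)) (ψ := ψ) (χ := fun ε => ψ + ε • w)
      (fun ε => hψc.add (hwc.const_smul ε)) (measurableSet_zeroSet hψc).compl (fun s hs => hs)
      (fun s _ => by
        have : Filter.Tendsto (fun ε : ℝ => ψ s + ε • w s) (nhds 0) (nhds (ψ s + (0 : ℝ) • w s)) :=
          tendsto_const_nhds.add (Filter.tendsto_id.smul_const _)
        simpa using this)
    rw [setIntegral_compl_zeroSet fun s hs => hs] at this
    refine this.congr fun ε => ?_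
    exact setIntegral_compl_zeroSet fun s hs => hsub ε hs
  -- For small ε the strict inequality persists in the limit of ∫ sgn, and the zero set can only
  -- grow because w vanishes on Z[ψ]. So ψ + εw is a competitor for both signs of ε.
  have hev : ∀ᶠ ε : ℝ in nhds 0, energy ψ * ∫ s, ‖(ψ + ε • w) s‖ ^ 2 ≤ energy (ψ + ε • w) := by
    filter_upwards [hlim.norm.eventually (gt_mem_nhds hlt)] with ε hε
    have hp := IsPrimitive.add hu (hw.const_smul ε) (memLp_two_integrable hg)
      ((memLp_two_integrable hγ).smul ε)
    refine hψ.mul_le_energy ⟨_, hg.add (hγ.const_smul ε), hp⟩ (hε.le.trans ?_)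
    exact measureReal_mono (hsub ε)
  have hEn : ∀ ε : ℝ, energy (ψ + ε • w) = ∫ s, ‖(g + ε • γ) s‖ ^ 2 := fun ε =>
    IsPrimitive.energy_eq (IsPrimitive.add hu (hw.const_smul ε) (memLp_two_integrable hg)
      ((memLp_two_integrable hγ).smul ε))
      ((memLp_two_integrable hg).add ((memLp_two_integrable hγ).smul ε))
  have hE0 : energy ψ = ∫ s, ‖g s‖ ^ 2 := IsPrimitive.energy_eq hu (memLp_two_integrable hg)
  -- The quadratic 2εB + ε²C has a local minimum at 0, so its linear coefficient B vanishes.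
  set B := (∫ s, inner ℝ (g s) (γ s)) - energy ψ * ∫ s, inner ℝ (ψ s) (w s) with hB
  set C := (∫ s, ‖γ s‖ ^ 2) - energy ψ * ∫ s, ‖w s‖ ^ 2 with hC
  have hmin : IsLocalMin (fun ε : ℝ => 2 * ε * B + ε ^ 2 * C) 0 := by
    filter_upwards [hev] with ε hε
    rw [hEn, integral_norm_add_smul_sq hg hγ,
      integral_norm_add_smul_sq (memLp_of_continuous hψc) (memLp_of_continuous hwc),
      hψ.1.normalized, ← hE0] at hε
    rw [hB, hC]
    nlinarith
  have hd : HasDerivAt (fun ε : ℝ => 2 * ε * B + ε ^ 2 * C) (2 * 1 * B + 2 * 0 ^ 1 * 1 * C) 0 := by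
    have h1 := ((hasDerivAt_id (0 : ℝ)).const_mul 2).mul_const B
    have h2 := ((hasDerivAt_id (0 : ℝ)).pow 2).mul_const C
    exact h1.add h2
  have := hmin.hasDerivAt_eq_zero hd
  linarith

end Variation

/-! ### The sine equation on a block, and the lower bound π for its length -/

section Sine

variable {n : ℕ}

theorem hasDerivAt_const_mul_sin (A ω p t : ℝ) :
    HasDerivAt (fun t : ℝ => A * Real.sin (ω * (t - p))) (A * ω * Real.cos (ω * (t - p))) t := by
  have h1 : HasDerivAt (fun t : ℝ => ω * (t - p)) (ω * 1) t :=
    ((hasDerivAt_id t).sub_const p).const_mul ω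
  exact (h1.sin.const_mul A).congr_deriv (by ring)

theorem integral_cos_piece {γ : S1 → E n} {ω A p c d : ℝ} {e : E n} (hcd : c ≤ d)
    (hγ : ∀ r ∈ Set.Ioc c d, γ (r : S1) = (A * ω * Real.cos (ω * (r - p))) • e) :
    ∫ t in c..d, γ (t : S1) =
      (A * Real.sin (ω * (d - p))) • e - (A * Real.sin (ω * (c - p))) • e := by
  have h1 : ∫ t in c..d, γ (t : S1) = ∫ r in c..d, (A * ω * Real.cos (ω * (r - p))) • e := by
    refine intervalIntegral.integral_congr_ae (Filter.Eventually.of_forall fun r hr => ?_)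
    rw [Set.uIoc_of_le hcd] at hr
    exact hγ r hr
  rw [h1, intervalIntegral.integral_smul_const, intervalIntegral.integral_eq_sub_of_hasDerivAt
    (fun r _ => hasDerivAt_const_mul_sin A ω p r)
    (Continuous.intervalIntegrable (by fun_prop) _ _), sub_smul]

/-- A function which is a multiple of a shifted sine on an interval, tested against `ψ`. -/
theorem sine_piece {ψ g w γ : S1 → E n} (hg : MemLp g 2 volume) (hu : IsPrimitive ψ g)
    (hw : IsPrimitive w γ) {ω A p c d : ℝ} {e : E n} (hcd : c ≤ d)
    (hc : w (c : S1) = (A * Real.sin (ω * (c - p))) • e)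
    (hγ : ∀ r ∈ Set.Ioc c d, γ (r : S1) = (A * ω * Real.cos (ω * (r - p))) • e) :
    (∀ t ∈ Set.Icc c d, w (t : S1) = (A * Real.sin (ω * (t - p))) • e) ∧
    ∫ t in c..d, inner ℝ (g (t : S1)) (γ (t : S1)) =
      inner ℝ ((A * ω * Real.cos (ω * (d - p))) • ψ (d : S1) -
        (A * ω * Real.cos (ω * (c - p))) • ψ (c : S1)) e +
      ω ^ 2 * ∫ t in c..d, inner ℝ (ψ (t : S1)) (w (t : S1)) := by
  have hθ' : ∀ t : ℝ, HasDerivAt (fun t : ℝ => A * ω * Real.cos (ω * (t - p)))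
      (-ω ^ 2 * (A * Real.sin (ω * (t - p)))) t := fun t => by
    have h1 : HasDerivAt (fun t : ℝ => ω * (t - p)) (ω * 1) t :=
      ((hasDerivAt_id t).sub_const p).const_mul ω
    exact (h1.cos.const_mul (A * ω)).congr_deriv (by ring)
  have hwt : ∀ t ∈ Set.Icc c d, w (t : S1) = (A * Real.sin (ω * (t - p))) • e := by
    intro t ht
    have h1 := hw c t
    rw [integral_cos_piece ht.1 fun r hr => hγ r ⟨hr.1, hr.2.trans ht.2⟩, ← hc] at h1
    exact sub_left_injective h1
  refine ⟨hwt, ?_⟩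
  have hgi := intervalIntegrable_coe (memLp_two_integrable hg) c d
  have hψc : Continuous ψ := IsPrimitive.continuous hu (memLp_two_integrable hg)
  have hψr : Continuous fun t : ℝ => ψ (t : S1) := hψc.comp (AddCircle.continuous_mk' _)
  have h1 : ∫ t in c..d, inner ℝ (g (t : S1)) (γ (t : S1)) =
      inner ℝ e (∫ t in c..d, (A * ω * Real.cos (ω * (t - p))) • g (t : S1)) := by
    refine Eq.trans ?_ ((innerSL ℝ e).intervalIntegral_comp_comm
      (hgi.continuousOn_smul (Continuous.continuousOn (by fun_prop))))
    refine intervalIntegral.integral_congr_ae (Filter.Eventually.of_forall fun r hr => ?_)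
    rw [Set.uIoc_of_le hcd] at hr
    rw [hγ r hr, innerSL_apply_apply, inner_smul_right, inner_smul_right, real_inner_comm]
  have h2 : ∫ t in c..d, inner ℝ (ψ (t : S1)) (w (t : S1)) =
      inner ℝ e (∫ t in c..d, (A * Real.sin (ω * (t - p))) • ψ (t : S1)) := by
    refine Eq.trans ?_ ((innerSL ℝ e).intervalIntegral_comp_comm
      (Continuous.intervalIntegrable (by fun_prop) _ _))
    refine intervalIntegral.integral_congr_ae (Filter.Eventually.of_forall fun r hr => ?_)
    rw [Set.uIoc_of_le hcd] at hr
    rw [hwt r ⟨hr.1.le, hr.2⟩, innerSL_apply_apply, inner_smul_right, inner_smul_right,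
      real_inner_comm]
  -- The derivative is moved from ψ to w'; as w'' = -ω²w, only boundary terms are added to the ω²
  -- term.
  have h3 := integral_smul_deriv_of_primitive hgi (fun t => hu c t) hθ' (by fun_prop)
  have h4 : ∫ t in c..d, (-ω ^ 2 * (A * Real.sin (ω * (t - p)))) • ψ (t : S1) =
      -(ω ^ 2 • ∫ t in c..d, (A * Real.sin (ω * (t - p))) • ψ (t : S1)) := by
    rw [← intervalIntegral.integral_smul, ← intervalIntegral.integral_neg]
    simp only [smul_smul, neg_mul, neg_smul]
  rw [h1, h2, h3, h4, sub_neg_eq_add, inner_add_right, inner_smul_right, real_inner_comm]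

/-- The derivative of a test function which consists of two sine arches. -/
def kinkDeriv (ω b t₁ t₂ r : ℝ) : ℝ :=
  if r ≤ t₁ then 0
  else if r ≤ t₂ then Real.sin (ω * (b - t₂)) * ω * Real.cos (ω * (r - t₁))
  else if r ≤ b then -Real.sin (ω * (t₂ - t₁)) * ω * Real.cos (ω * (r - b))
  else 0

theorem measurable_kinkDeriv (ω b t₁ t₂ : ℝ) : Measurable (kinkDeriv ω b t₁ t₂) := by
  unfold kinkDeriv
  refine Measurable.ite measurableSet_Iic measurable_const (Measurable.ite measurableSet_Iic
    (by fun_prop) (Measurable.ite measurableSet_Iic (by fun_prop) measurable_const))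

theorem abs_kinkDeriv_le (ω b t₁ t₂ r : ℝ) : |kinkDeriv ω b t₁ t₂ r| ≤ |ω| := by
  have key : ∀ x y : ℝ, |x| ≤ 1 → |y| ≤ 1 → |x * ω * y| ≤ |ω| := fun x y hx hy => by
    rw [abs_mul, abs_mul]
    have := mul_le_mul hx hy (abs_nonneg _) zero_le_one
    nlinarith [abs_nonneg ω]
  unfold kinkDeriv
  split_ifs
  · simp
  · exact key _ _ (Real.abs_sin_le_one _) (Real.abs_cos_le_one _)
  · exact key _ _ (by rw [abs_neg]; exact Real.abs_sin_le_one _) (Real.abs_cos_le_one _)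
  · simp

theorem memLp_liftIoc_smul {f : ℝ → ℝ} (hf : Measurable f) {C : ℝ} (hC : ∀ r, |f r| ≤ C) (a : ℝ)
    (e : E n) : MemLp (fun s : S1 => AddCircle.liftIoc (2 * Real.pi) a f s • e) 2 volume := by
  have hm : Measurable (AddCircle.liftIoc (2 * Real.pi) a f) :=
    hf.comp (measurable_subtype_coe.comp (AddCircle.measurableEquivIoc (2 * Real.pi) a).measurable)
  refine MemLp.of_bound (hm.smul_const e).aestronglyMeasurable (C * ‖e‖)
    (Filter.Eventually.of_forall fun s => ?_)
  rw [norm_smul]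
  exact mul_le_mul_of_nonneg_right (hC _) (norm_nonneg _)

/-- If the weak loop condition is not active, then on each block a minimizer solves
`ψ'' = -ω² ψ`; here in an integrated form. -/
theorem IsMinimizer.sin_smul_eq {ψ : S1 → E n} {a b ω : ℝ} (hψ : IsMinimizer ψ)
    (hab : IsBlock ψ a b) (hZ : zeroSet ψ = (openArc a b)ᶜ)
    (hlt : ‖∫ s, sgn (ψ s)‖ < volume.real (zeroSet ψ)) (hω : energy ψ = ω ^ 2) (hω0 : 0 < ω)
    {t₁ t₂ : ℝ} (h₁ : a ≤ t₁) (h₁₂ : t₁ ≤ t₂) (h₂ : t₂ ≤ b) :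
    Real.sin (ω * (b - t₁)) • ψ (t₂ : S1) = Real.sin (ω * (b - t₂)) • ψ (t₁ : S1) := by
  obtain ⟨g, hg, hu⟩ := hψ.1.memW12
  have hb : b ≤ a + 2 * Real.pi := hab.le
  refine ext_inner_right ℝ fun e => ?_
  -- The test function w with derivative γ is a Green's function type profile: zero up to t₁, one
  -- sine arch on [t₁, t₂], another on [t₂, b], zero after b. It solves w'' = -ω²w except for kinks,
  -- so the Euler-Lagrange equation reduces to a relation between ψ(t₁) and ψ(t₂); the kink at b
  -- drops out as ψ(b) = 0.
  set γ : S1 → E n := fun s => AddCircle.liftIoc (2 * Real.pi) a (kinkDeriv ω b t₁ t₂) s • e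
    with hγdef
  have hγ : MemLp γ 2 volume :=
    memLp_liftIoc_smul (measurable_kinkDeriv ω b t₁ t₂) (abs_kinkDeriv_le ω b t₁ t₂) a e
  have hγi := memLp_two_integrable hγ
  have hγt : ∀ r ∈ Set.Ioc a (a + 2 * Real.pi), γ (r : S1) = kinkDeriv ω b t₁ t₂ r • e :=
    fun r hr => by rw [hγdef]; simp only [AddCircle.liftIoc_coe_apply hr]
  have g1 : ∀ r ∈ Set.Ioc a t₁, γ (r : S1) = (0 * ω * Real.cos (ω * (r - 0))) • e := fun r hr => by
    rw [hγt r ⟨hr.1, by linarith [hr.2]⟩, kinkDeriv, if_pos hr.2, zero_mul, zero_mul]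
  have g2 : ∀ r ∈ Set.Ioc t₁ t₂, γ (r : S1) =
      (Real.sin (ω * (b - t₂)) * ω * Real.cos (ω * (r - t₁))) • e := fun r hr => by
    rw [hγt r ⟨by linarith [hr.1], by linarith [hr.2]⟩, kinkDeriv, if_neg (not_le.2 hr.1),
      if_pos hr.2]
  have g3 : ∀ r ∈ Set.Ioc t₂ b, γ (r : S1) =
      (-Real.sin (ω * (t₂ - t₁)) * ω * Real.cos (ω * (r - b))) • e := fun r hr => by
    rw [hγt r ⟨by linarith [hr.1], by linarith [hr.2]⟩, kinkDeriv,
      if_neg (by linarith [hr.1]), if_neg (not_le.2 hr.1), if_pos hr.2]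
  have g4 : ∀ r ∈ Set.Ioc b (a + 2 * Real.pi), γ (r : S1) =
      (0 * ω * Real.cos (ω * (r - 0))) • e := fun r hr => by
    rw [hγt r ⟨by linarith [hr.1, hab.lt], hr.2⟩, kinkDeriv,
      if_neg (by linarith [hr.1]), if_neg (by linarith [hr.1]), if_neg (not_le.2 hr.1),
      zero_mul, zero_mul]
  have hγ0 : ∫ s, γ s = 0 := by
    have i := intervalIntegrable_coe hγi
    have hs : Real.sin (ω * (t₂ - b)) = -Real.sin (ω * (b - t₂)) := by
      rw [← Real.sin_neg]; congr 1; ring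
    rw [integral_circle _ a,
      ← intervalIntegral.integral_add_adjacent_intervals (i a t₁) (i t₁ _),
      ← intervalIntegral.integral_add_adjacent_intervals (i t₁ t₂) (i t₂ _),
      ← intervalIntegral.integral_add_adjacent_intervals (i t₂ b) (i b _),
      integral_cos_piece h₁ g1, integral_cos_piece h₁₂ g2, integral_cos_piece h₂ g3,
      integral_cos_piece hb g4, hs]
    simp only [sub_self, mul_zero, Real.sin_zero, zero_mul, zero_smul, sub_zero]
    rw [zero_add, zero_sub, add_zero, ← sub_eq_add_neg, ← sub_smul]
    convert zero_smul ℝ e using 2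
    ring
  obtain ⟨w, hwa, hw⟩ := exists_isPrimitive hγi hγ0 a 0
  obtain ⟨w1, p1⟩ := sine_piece hg hu hw h₁ (by rw [hwa, zero_mul, zero_smul]) g1
  obtain ⟨w2, p2⟩ := sine_piece hg hu hw h₁₂ (by
    rw [w1 t₁ ⟨h₁, le_rfl⟩, zero_mul, sub_self, mul_zero, Real.sin_zero, mul_zero]) g2
  -- The amplitudes in `kinkDeriv` are chosen so that both arches take the value sin(ω(b - t₂))
  -- sin(ω(t₂ - t₁)) e at t₂.
  obtain ⟨w3, p3⟩ := sine_piece hg hu hw h₂ (by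
    rw [w2 t₂ ⟨h₁₂, le_rfl⟩, ← neg_sub b t₂, mul_neg, Real.sin_neg, neg_mul_neg, mul_comm]) g3
  obtain ⟨w4, p4⟩ := sine_piece hg hu hw hb (by
    rw [w3 b ⟨h₂, le_rfl⟩, sub_self, mul_zero, Real.sin_zero, mul_zero, zero_mul]) g4
  have hw0 : ∀ s ∈ zeroSet ψ, w s = 0 := by
    rw [hZ, compl_openArc hab.lt hb]
    rintro _ ⟨t, ht, rfl⟩
    rw [w4 t ht, zero_mul, zero_smul]
  have key := hψ.integral_inner_eq hg hu hlt hγ hw hw0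
  have i1 := intervalIntegrable_coe (integrable_inner_of_memLp hg hγ)
  have i2 := intervalIntegrable_coe (integrable_inner_of_memLp
    (memLp_of_continuous hψ.1.memW12.continuous) (memLp_of_continuous (hw.continuous hγi)))
  rw [integral_circle _ a, integral_circle _ a,
    ← intervalIntegral.integral_add_adjacent_intervals (i1 a t₁) (i1 t₁ _),
    ← intervalIntegral.integral_add_adjacent_intervals (i1 t₁ t₂) (i1 t₂ _),
    ← intervalIntegral.integral_add_adjacent_intervals (i1 t₂ b) (i1 b _),
    ← intervalIntegral.integral_add_adjacent_intervals (i2 a t₁) (i2 t₁ _),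
    ← intervalIntegral.integral_add_adjacent_intervals (i2 t₁ t₂) (i2 t₂ _),
    ← intervalIntegral.integral_add_adjacent_intervals (i2 t₂ b) (i2 b _),
    p1, p2, p3, p4, hω, hab.right] at key
  simp only [zero_mul, zero_smul, sub_self, inner_zero_left, smul_zero, zero_sub, inner_neg_left,
    inner_sub_left, real_inner_smul_left, mul_zero, Real.cos_zero, mul_one] at key
  rw [real_inner_smul_left, real_inner_smul_left]
  -- The addition theorem identifies the drop of w' at t₂ as ω sin(ω(b - t₁)) e.
  have hs : Real.sin (ω * (b - t₁)) = Real.sin (ω * (b - t₂)) * Real.cos (ω * (t₂ - t₁)) +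
      Real.cos (ω * (b - t₂)) * Real.sin (ω * (t₂ - t₁)) := by
    rw [← Real.sin_add]; congr 1; ring
  have hc : Real.cos (ω * (t₂ - b)) = Real.cos (ω * (b - t₂)) := by
    rw [← Real.cos_neg]; congr 1; ring
  rw [hc] at key
  refine mul_left_cancel₀ hω0.ne' ?_
  rw [hs]
  linear_combination key

/-- With zero energy ψ is constant, and a zero then makes it vanish identically. -/
theorem energy_pos {ψ : S1 → E n} (hW : MemW12 ψ) (hn : ∫ s, ‖ψ s‖ ^ 2 = 1)
    (h0 : (zeroSet ψ).Nonempty) : 0 < energy ψ := by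
  refine (energy_nonneg ψ).lt_of_ne' fun h => ?_
  obtain ⟨g, hg, hu⟩ := hW
  rw [IsPrimitive.energy_eq hu (memLp_two_integrable hg), integral_eq_zero_iff_of_nonneg
    (fun _ => by positivity) (hg.integrable_norm_pow (by norm_num))] at h
  have hg0 : g =ᵐ[volume] 0 := by
    filter_upwards [h] with s hs
    simpa using hs
  obtain ⟨z, hz⟩ := h0
  obtain ⟨a, rfl⟩ := QuotientAddGroup.mk_surjective z
  have hψ0 : ∀ s, ψ s = 0 := fun s => by
    obtain ⟨t, rfl⟩ := QuotientAddGroup.mk_surjective s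
    have h1 := (IsPrimitive.congr hu hg0) a t
    simp only [Pi.zero_apply, intervalIntegral.integral_zero] at h1
    rw [sub_eq_zero] at h1
    exact h1.trans hz
  simp [hψ0] at hn

/-- In a minimizer that consists of a single block, the weak loop condition is active. -/
theorem IsMinimizer.norm_integral_sgn_eq_of_block {ψ : S1 → E n} {a b : ℝ} (hψ : IsMinimizer ψ)
    (hE : energy ψ ≤ 1) (hab : IsBlock ψ a b) (hZ : zeroSet ψ = (openArc a b)ᶜ) :
    ‖∫ s, sgn (ψ s)‖ = volume.real (zeroSet ψ) := by
  refine hψ.1.weakLoop.eq_of_not_lt fun hlt => ?_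
  have hvol : volume.real (zeroSet ψ) = 2 * Real.pi - (b - a) := by
    rw [hZ, measureReal_compl_openArc hab.lt.le hab.le]
  have hpos : 0 < energy ψ := energy_pos hψ.1.memW12 hψ.1.normalized ⟨_, hab.left⟩
  set ω := √(energy ψ) with hωdef
  have hω0 : 0 < ω := Real.sqrt_pos.2 hpos
  have hω1 : ω ≤ 1 := Real.sqrt_le_one.2 hE
  have hωE : energy ψ = ω ^ 2 := (Real.sq_sqrt hpos.le).symm
  have hsin := fun {t₁ t₂ : ℝ} => hψ.sin_smul_eq hab hZ hlt hωE hω0 (t₁ := t₁) (t₂ := t₂)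
  set m := (a + b) / 2 with hm
  have ham : a < m := by rw [hm]; linarith [hab.lt]
  have hmb : m < b := by rw [hm]; linarith [hab.lt]
  have hm0 := hab.ne_zero m ⟨ham, hmb⟩
  -- Compare the left end, where ψ vanishes, with the midpoint, where it does not.
  have hsin0 : Real.sin (ω * (b - a)) = 0 := by
    have := hsin le_rfl ham.le hmb.le
    rw [hab.left, smul_zero] at this
    exact (smul_eq_zero.1 this).resolve_right hm0
  -- Strict inequality forces the zero set to have positive measure. With ω ≤ 1 this leaves room for
  -- fewer than two half-waves.
  have hlen : b - a < 2 * Real.pi := by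
    have := (norm_nonneg _).trans_lt hlt
    linarith
  have hωl : ω * (b - a) < 2 * Real.pi := by nlinarith [hab.lt]
  have hωlpos : 0 < ω * (b - a) := mul_pos hω0 (sub_pos.2 hab.lt)
  have hπ : ω * (b - a) = Real.pi := by
    obtain ⟨k, hk⟩ := Real.sin_eq_zero_iff.1 hsin0
    have hk1 : 0 < (k : ℝ) := by
      by_contra h
      nlinarith [Real.pi_pos]
    have hk2 : (k : ℝ) < 2 := by
      by_contra h
      nlinarith [Real.pi_pos]
    have hk3 : k = 1 := by
      have : 0 < k := by exact_mod_cast hk1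
      have : k < 2 := by exact_mod_cast hk2
      omega
    rw [← hk, hk3]; simp
  have hl : Real.pi ≤ b - a := by nlinarith [hab.lt]
  have hsp : ∀ t ∈ Set.Ioo a b, 0 < Real.sin (ω * (b - t)) := fun t ht =>
    Real.sin_pos_of_pos_of_lt_pi (mul_pos hω0 (sub_pos.2 ht.2)) (by nlinarith [ht.1])
  have hsgn : ∀ t ∈ Set.Ioo a b, sgn (ψ (t : S1)) = sgn (ψ (m : S1)) := by
    intro t ht
    have key : Real.sin (ω * (b - m)) • ψ (t : S1) = Real.sin (ω * (b - t)) • ψ (m : S1) := by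
      rcases le_total t m with h | h
      · exact (hsin ht.1.le h hmb.le).symm
      · exact hsin ham.le h ht.2.le
    rw [← sgn_smul (hsp m ⟨ham, hmb⟩), key, sgn_smul (hsp t ht)]
  -- On the block ψ is a positive multiple of ψ(m), so no cancellation occurs: the norm is b - a ≥
  -- π, hence at least 2π - (b - a), against `hlt`.
  have hint : ∫ s, sgn (ψ s) = (b - a) • sgn (ψ (m : S1)) := by
    rw [integral_of_eq_zero_off_openArc hab.lt.le hab.le fun s hs => by
      have : s ∈ zeroSet ψ := hZ ▸ hs
      rw [show ψ s = 0 from this, sgn_zero]]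
    rw [intervalIntegral.integral_of_le hab.lt.le, integral_Ioc_eq_integral_Ioo,
      setIntegral_congr_fun measurableSet_Ioo hsgn]
    simp [hab.lt.le]
  rw [hint, hvol, norm_smul, norm_sgn hm0, mul_one, Real.norm_eq_abs,
    abs_of_pos (sub_pos.2 hab.lt)] at hlt
  linarith

/-- The direction vector integrated over a block of a minimizer. -/
theorem IsMinimizer.norm_integral_sgn_block {ψ : S1 → E n} {a b : ℝ} (hψ : IsMinimizer ψ)
    (hE : energy ψ ≤ 1) (hab : IsBlock ψ a b) :
    ‖∫ t in a..b, sgn (ψ (t : S1))‖ = 2 * Real.pi - (b - a) := by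
  obtain ⟨χ, hχ, hχE, hχZ, hχs⟩ := hψ.exists_isMinimizer_block hab
  have hmem : ∀ s : S1, χ s = 0 ↔ s ∉ openArc a b := fun s => by
    have : s ∈ zeroSet χ ↔ s ∈ (openArc a b)ᶜ := by rw [hχZ]
    exact this
  have hZψ : ∀ t : ℝ, ψ (t : S1) = 0 → χ (t : S1) = 0 := fun t ht => by
    rw [hmem]
    rintro ⟨r, hr, hrt⟩
    exact hab.ne_zero r hr ((congrArg ψ hrt).trans ht)
  have hblock : IsBlock χ a b := ⟨hab.lt, hab.le, hZψ a hab.left, hZψ b hab.right, fun t ht h =>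
    (hmem _).1 h ⟨t, ht, rfl⟩⟩
  have h1 := hχ.norm_integral_sgn_eq_of_block (hχE.le.trans hE) hblock hχZ
  rw [hχZ, measureReal_compl_openArc hab.lt.le hab.le] at h1
  rw [← h1, ← setIntegral_openArc (fun s => sgn (ψ s)) hab.lt.le hab.le,
    ← setIntegral_congr_fun (measurableSet_openArc a b) hχs]
  congr 1
  exact setIntegral_eq_integral_of_forall_compl_eq_zero fun s hs => by
    rw [(hmem s).2 hs, sgn_zero]

/-- The integral of sgn ψ has norm 2π - (b - a), but never more than b - a. -/
theorem IsMinimizer.pi_le_block {ψ : S1 → E n} {a b : ℝ} (hψ : IsMinimizer ψ)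
    (hE : energy ψ ≤ 1) (hab : IsBlock ψ a b) : Real.pi ≤ b - a := by
  have h1 := hψ.norm_integral_sgn_block hE hab
  have h2 := intervalIntegral.norm_integral_le_of_norm_le_const (a := a) (b := b)
    (f := fun t : ℝ => sgn (ψ (t : S1))) (C := 1) fun r _ => norm_sgn_le _
  rw [one_mul, abs_of_pos (sub_pos.2 hab.lt)] at h2
  linarith

end Sine

/-! ### At most two blocks; equality in the loop condition -/

section Structure

variable {n : ℕ} {ψ : S1 → E n}

theorem exists_isBlock (hψ : Continuous ψ) (h0 : (zeroSet ψ).Nonempty) {t₀ : ℝ}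
    (ht₀ : ψ (t₀ : S1) ≠ 0) : ∃ a b, IsBlock ψ a b ∧ t₀ ∈ Set.Ioo a b := by
  set Z : Set ℝ := {t : ℝ | ψ (t : S1) = 0} with hZ
  have hZc : IsClosed Z := isClosed_eq (hψ.comp (AddCircle.continuous_mk' _)) continuous_const
  obtain ⟨z, hz⟩ := h0
  -- A zero within one period to the left of t₀, and its translate to the right, make the last zero
  -- before and the first zero after t₀ well defined.
  obtain ⟨z₁, hz₁, hz₁z⟩ := exists_coe_mem_Ioc (t₀ - 2 * Real.pi) z
  have hz₁Z : z₁ ∈ Z := by rw [hZ, Set.mem_ofPred_eq, hz₁z]; exact hz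
  rw [sub_add_cancel] at hz₁
  have hz₂Z : z₁ + 2 * Real.pi ∈ Z := by
    rw [hZ, Set.mem_ofPred_eq, coe_add_two_pi]; exact hz₁Z
  have hA : (Z ∩ Set.Iic t₀).Nonempty := ⟨z₁, hz₁Z, hz₁.2⟩
  have hAb : BddAbove (Z ∩ Set.Iic t₀) := ⟨t₀, fun t ht => ht.2⟩
  have hB : (Z ∩ Set.Ici t₀).Nonempty := ⟨z₁ + 2 * Real.pi, hz₂Z, by
    rw [Set.mem_Ici]; linarith [hz₁.1]⟩
  have hBb : BddBelow (Z ∩ Set.Ici t₀) := ⟨t₀, fun t ht => ht.2⟩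
  have hamem := (hZc.inter isClosed_Iic).csSup_mem hA hAb
  have hbmem := (hZc.inter isClosed_Ici).csInf_mem hB hBb
  set a := sSup (Z ∩ Set.Iic t₀) with ha
  set b := sInf (Z ∩ Set.Ici t₀) with hb
  have hat : a < t₀ := lt_of_le_of_ne hamem.2 fun h => ht₀ (h ▸ hamem.1)
  have htb : t₀ < b := lt_of_le_of_ne hbmem.2 fun h => ht₀ (h ▸ hbmem.1)
  have hza : z₁ ≤ a := le_csSup hAb ⟨hz₁Z, hz₁.2⟩
  refine ⟨a, b, ⟨hat.trans htb, ?_, hamem.1, hbmem.1, fun t ht h => ?_⟩, hat, htb⟩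
  · refine csInf_le hBb ⟨?_, ?_⟩
    · rw [hZ, Set.mem_ofPred_eq, coe_add_two_pi]; exact hamem.1
    · rw [Set.mem_Ici]; linarith [hz₁.1]
  · rcases le_total t t₀ with htt | htt
    · exact absurd (le_csSup hAb ⟨h, htt⟩) (not_le.2 ht.1)
    · exact absurd (csInf_le hBb ⟨h, htt⟩) (not_le.2 ht.2)

theorem zeroSet_eq_of_block {a b : ℝ} (h : IsBlock ψ a b)
    (h0 : ∀ t ∈ Set.Icc b (a + 2 * Real.pi), ψ (t : S1) = 0) : zeroSet ψ = (openArc a b)ᶜ := by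
  rw [compl_openArc h.lt h.le]
  ext s
  obtain ⟨t, ht, rfl⟩ := exists_coe_mem_Ioc a s
  constructor
  · intro hs
    refine ⟨t, ⟨?_, ht.2⟩, rfl⟩
    by_contra htb
    exact h.ne_zero t ⟨ht.1, not_le.1 htb⟩ hs
  · rintro ⟨r, hr, hrt⟩
    exact (congrArg ψ hrt).symm.trans (h0 r hr)

/-- Blocks are disjoint and each has length at least π on a circle of length 2π, so a second block
fills up the circle. -/
theorem IsMinimizer.blocks (hψ : IsMinimizer ψ) (hE : energy ψ ≤ 1) :
    zeroSet ψ = ∅ ∨ (∃ a b, IsBlock ψ a b ∧ zeroSet ψ = (openArc a b)ᶜ) ∨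
      ∃ a, IsBlock ψ a (a + Real.pi) ∧ IsBlock ψ (a + Real.pi) (a + 2 * Real.pi) := by
  rcases (zeroSet ψ).eq_empty_or_nonempty with h0 | h0
  · exact Or.inl h0
  refine Or.inr ?_
  have hc := hψ.1.memW12.continuous
  obtain ⟨t₀, ht₀⟩ : ∃ t₀ : ℝ, ψ (t₀ : S1) ≠ 0 := by
    by_contra! h
    have : ∀ s, ψ s = 0 := fun s => by
      obtain ⟨t, rfl⟩ := QuotientAddGroup.mk_surjective s
      exact h t
    have h1 := hψ.1.normalized
    simp [this] at h1
  obtain ⟨a, b, hab, -⟩ := exists_isBlock hc h0 ht₀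
  by_cases hall : ∀ t ∈ Set.Icc b (a + 2 * Real.pi), ψ (t : S1) = 0
  · exact Or.inl ⟨a, b, hab, zeroSet_eq_of_block hab hall⟩
  refine Or.inr ⟨a, ?_⟩
  push Not at hall
  obtain ⟨t₁, ht₁, hne⟩ := hall
  obtain ⟨c, d, hcd, hct, htd⟩ := exists_isBlock hc h0 hne
  -- Blocks cannot overlap, since an end point of one is a zero and cannot lie inside the other.
  have hbc : b ≤ c := by
    by_contra h
    exact hcd.ne_zero b ⟨not_le.1 h, ht₁.1.trans_lt htd⟩ hab.right
  have hda : d ≤ a + 2 * Real.pi := by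
    by_contra h
    refine hcd.ne_zero (a + 2 * Real.pi) ⟨hct.trans_le ht₁.2, not_le.1 h⟩ ?_
    rw [coe_add_two_pi]; exact hab.left
  have l1 := hψ.pi_le_block hE hab
  have l2 := hψ.pi_le_block hE hcd
  have e1 : b = a + Real.pi := by linarith
  have e2 : c = a + Real.pi := by linarith
  have e3 : d = a + 2 * Real.pi := by linarith
  rw [e1] at hab
  rw [e2, e3] at hcd
  exact ⟨hab, hcd⟩

theorem zeroSet_of_two_blocks {a : ℝ} (h1 : IsBlock ψ a (a + Real.pi))
    (h2 : IsBlock ψ (a + Real.pi) (a + 2 * Real.pi)) :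
    zeroSet ψ = {(a : S1), ((a + Real.pi : ℝ) : S1)} := by
  ext s
  obtain ⟨t, ht, rfl⟩ := exists_coe_mem_Ioc a s
  rw [Set.mem_insert_iff, Set.mem_singleton_iff]
  constructor
  · intro hs
    rcases lt_trichotomy t (a + Real.pi) with h | h | h
    · exact absurd hs (h1.ne_zero t ⟨ht.1, h⟩)
    · exact Or.inr (congrArg _ h)
    · rcases ht.2.lt_or_eq with h' | h'
      · exact absurd hs (h2.ne_zero t ⟨h, h'⟩)
      · left; rw [h', coe_add_two_pi]
  · rintro (h | h)
    · exact (congrArg ψ h).trans h1.left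
    · exact (congrArg ψ h).trans h1.right

theorem norm_integral_sgn_eq_of_measure_zero (hloop : ‖∫ s, sgn (ψ s)‖ ≤ volume.real (zeroSet ψ))
    (h : volume.real (zeroSet ψ) = 0) : ‖∫ s, sgn (ψ s)‖ = volume.real (zeroSet ψ) :=
  le_antisymm hloop (h ▸ norm_nonneg _)

theorem volume_singleton_circle (s : S1) : volume ({s} : Set S1) = 0 := by
  rw [← Metric.closedBall_zero, AddCircle.volume_closedBall, mul_zero,
    min_eq_right Real.two_pi_pos.le, ENNReal.ofReal_zero]

theorem measureReal_zeroSet_of_two_blocks {a : ℝ} (h1 : IsBlock ψ a (a + Real.pi))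
    (h2 : IsBlock ψ (a + Real.pi) (a + 2 * Real.pi)) : volume.real (zeroSet ψ) = 0 := by
  rw [zeroSet_of_two_blocks h1 h2, Measure.real, Set.insert_eq,
    measure_union_null (volume_singleton_circle _) (volume_singleton_circle _), ENNReal.toReal_zero]

/-- In every minimizer the weak loop condition is active. -/
theorem IsMinimizer.norm_integral_sgn_eq (hψ : IsMinimizer ψ) (hE : energy ψ ≤ 1) :
    ‖∫ s, sgn (ψ s)‖ = volume.real (zeroSet ψ) := by
  rcases hψ.blocks hE with h | ⟨a, b, hab, hZ⟩ | ⟨a, h1, h2⟩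
  · exact norm_integral_sgn_eq_of_measure_zero hψ.1.weakLoop (by rw [h]; simp)
  · exact hψ.norm_integral_sgn_eq_of_block hE hab hZ
  · exact norm_integral_sgn_eq_of_measure_zero hψ.1.weakLoop
      (measureReal_zeroSet_of_two_blocks h1 h2)

end Structure

/-! ### The velocity of associated curves, and di-gons -/

section Velocity

variable {n : ℕ} {ψ : S1 → E n}

/-- The equality case of the triangle inequality for integrals. -/
theorem ae_eq_of_integral_eq {α : Type*} [MeasurableSpace α] {μ : Measure α} [IsFiniteMeasure μ]
    {f : α → E n} {e : E n} (hf : Integrable f μ) (h1 : ∀ᵐ s ∂μ, ‖f s‖ ≤ 1) (he : ‖e‖ = 1)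
    (h : ∫ s, f s ∂μ = μ.real Set.univ • e) : ∀ᵐ s ∂μ, f s = e := by
  -- The function 1 - ⟨e, f⟩ is nonnegative with zero integral, so ⟨e, f⟩ = 1 a.e., which with ‖f‖ ≤
  -- 1 forces f = e.
  have hi : Integrable (fun s => 1 - inner ℝ e (f s)) μ :=
    (integrable_const 1).sub (hf.const_inner e)
  have h0 : ∫ s, (1 - inner ℝ e (f s)) ∂μ = 0 := by
    rw [integral_sub (integrable_const 1) (hf.const_inner e), integral_inner hf, h,
      inner_smul_right, real_inner_self_eq_norm_sq, he]
    simp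
  have hle : ∀ᵐ s ∂μ, 0 ≤ 1 - inner ℝ e (f s) := by
    filter_upwards [h1] with s hs
    have := real_inner_le_norm e (f s)
    rw [he, one_mul] at this
    linarith
  filter_upwards [(integral_eq_zero_iff_of_nonneg_ae hle hi).1 h0, h1] with s hs hs1
  have hs' : inner ℝ e (f s) = 1 := by
    have : 1 - inner ℝ e (f s) = 0 := hs
    linarith
  have : ‖f s - e‖ ^ 2 ≤ 0 := by
    rw [norm_sub_sq_real, real_inner_comm, hs', he]
    nlinarith [norm_nonneg (f s)]
  rw [← sub_eq_zero, ← norm_eq_zero]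
  exact pow_eq_zero_iff two_ne_zero |>.1 (le_antisymm this (by positivity))

/-- With N = ∫ sgn ψ and m = σ(Z[ψ]), e is the constant velocity on Z[ψ] that closes the curve. For
N = 0 any unit vector serves, and one exists because n ≥ 1. -/
theorem exists_direction (hn : 1 ≤ n) {m : ℝ} {N : E n} (h : ‖N‖ = m) :
    ∃ e : E n, ‖e‖ = 1 ∧ N = -(m • e) := by
  rcases eq_or_ne N 0 with rfl | hN
  · refine ⟨EuclideanSpace.single ⟨0, hn⟩ 1, by simp, ?_⟩
    rw [← h]; simp
  · refine ⟨-sgn N, by rw [norm_neg, norm_sgn hN], ?_⟩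
    rw [← h, smul_neg, neg_neg, norm_smul_sgn]

/-- The velocity of the associated curve. -/
def velocity (ψ : S1 → E n) (e : E n) (s : S1) : E n :=
  sgn (ψ s) + (zeroSet ψ).indicator (fun _ => e) s

theorem velocity_of_ne {e : E n} {s : S1} (h : ψ s ≠ 0) : velocity ψ e s = sgn (ψ s) := by
  rw [velocity, Set.indicator_of_notMem (show s ∉ zeroSet ψ from h), add_zero]

theorem velocity_of_eq {e : E n} {s : S1} (h : ψ s = 0) : velocity ψ e s = e := by
  rw [velocity, Set.indicator_of_mem (show s ∈ zeroSet ψ from h), h, sgn_zero, zero_add]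

theorem norm_velocity {e : E n} (he : ‖e‖ = 1) (s : S1) : ‖velocity ψ e s‖ = 1 := by
  by_cases h : ψ s = 0
  · rw [velocity_of_eq h, he]
  · rw [velocity_of_ne h, norm_sgn h]

theorem integrable_velocity (hψ : Continuous ψ) (e : E n) : Integrable (velocity ψ e) :=
  (integrable_sgn hψ).add ((integrable_const e).indicator (measurableSet_zeroSet hψ))

theorem integral_velocity (hψ : Continuous ψ) {e : E n}
    (h : ∫ s, sgn (ψ s) = -(volume.real (zeroSet ψ) • e)) : ∫ s, velocity ψ e s = 0 := by
  have : ∫ s, velocity ψ e s =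
      (∫ s, sgn (ψ s)) + ∫ s, (zeroSet ψ).indicator (fun _ => e) s :=
    integral_add (integrable_sgn hψ) ((integrable_const e).indicator (measurableSet_zeroSet hψ))
  rw [this, h, integral_indicator (measurableSet_zeroSet hψ), setIntegral_const, neg_add_cancel]

theorem isAssociatedCurve_of_isPrimitive {x : S1 → E n} (hψ : Continuous ψ) {e : E n}
    (he : ‖e‖ = 1) (hx : IsPrimitive x (velocity ψ e)) : IsAssociatedCurve ψ x := by
  have hd := hx.circleDeriv_ae (integrable_velocity hψ e)
  refine ⟨⟨1, hx.lipschitz fun s => (norm_velocity he s).le⟩, ?_, ?_⟩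
  · filter_upwards [hd] with s hs
    rw [hs, norm_velocity he]
  · filter_upwards [hd] with s hs
    rw [hs, amplitude]
    by_cases h : ψ s = 0
    · rw [h, norm_zero, zero_smul]
    · rw [velocity_of_ne h, norm_smul_sgn]

theorem measurable_circleDeriv (x : S1 → E n) : Measurable (circleDeriv x) := by
  have h : circleDeriv x = (fun t : ℝ => deriv (fun r : ℝ => x (r : S1)) t) ∘
      (fun y : Set.Ioc (0 : ℝ) (0 + 2 * Real.pi) => (y : ℝ)) ∘
      AddCircle.measurableEquivIoc (2 * Real.pi) 0 := by
    ext1 s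
    rw [Function.comp_apply, Function.comp_apply, ← circleDeriv_coe]
    congr 1
    exact ((AddCircle.equivIoc (2 * Real.pi) 0).symm_apply_apply s).symm
  rw [h]
  exact (measurable_deriv _).comp
    (measurable_subtype_coe.comp (AddCircle.measurableEquivIoc (2 * Real.pi) 0).measurable)

/-- Off Z[ψ] the relation ψ = φx' forces x' = sgn ψ. Closedness then gives ∫ x' = σ(Z[ψ]) e over
Z[ψ], and with unit speed this is the equality case of the triangle inequality. So associated curves
are unique up to translation. -/
theorem IsAssociatedCurve.isPrimitive {x : S1 → E n} (hx : IsAssociatedCurve ψ x)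
    (hψ : Continuous ψ) {e : E n} (he : ‖e‖ = 1)
    (h : ∫ s, sgn (ψ s) = -(volume.real (zeroSet ψ) • e)) : IsPrimitive x (velocity ψ e) := by
  obtain ⟨K, hK⟩ := hx.lipschitz
  have hp := isPrimitive_circleDeriv_of_lipschitz hK
  have hi : Integrable (circleDeriv x) :=
    Integrable.of_bound (measurable_circleDeriv x).aestronglyMeasurable 1
      (hx.unitSpeed.mono fun s hs => hs.le)
  have hZ := measurableSet_zeroSet hψ
  have hU : ∀ᵐ s, s ∈ (zeroSet ψ)ᶜ → circleDeriv x s = sgn (ψ s) := by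
    filter_upwards [hx.eq_smul] with s hs hsU
    have h0 : 0 < ‖ψ s‖ := norm_pos_iff.2 hsU
    rw [sgn]
    nth_rewrite 2 [hs]
    rw [amplitude, smul_smul, inv_mul_cancel₀ h0.ne', one_smul]
  have h1 := integral_add_compl hZ hi
  rw [hp.integral_eq_zero, setIntegral_congr_ae hZ.compl hU,
    setIntegral_compl_zeroSet fun s hs => hs, h, ← sub_eq_add_neg, sub_eq_zero] at h1
  have h2 : ∀ᵐ s ∂volume.restrict (zeroSet ψ), circleDeriv x s = e :=
    ae_eq_of_integral_eq hi.restrict (ae_restrict_of_ae (hx.unitSpeed.mono fun s hs => hs.le)) he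
      (by rw [h1]; simp)
  refine hp.congr ?_
  filter_upwards [hU, (ae_restrict_iff' hZ).1 h2] with s hs1 hs2
  by_cases hs : ψ s = 0
  · rw [velocity_of_eq hs, hs2 hs]
  · rw [velocity_of_ne hs, hs1 hs]

theorem IsPrimitive.eq_add_smul {x f : S1 → E n} (hx : IsPrimitive x f) {a b : ℝ} {v : E n}
    (h : ∀ᵐ t : ℝ, t ∈ Set.Ioo a b → f (t : S1) = v) {t : ℝ} (ht : t ∈ Set.Icc a b) :
    x (t : S1) = x (a : S1) + (t - a) • v := by
  rw [← sub_eq_iff_eq_add', hx a t]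
  have : ∫ r in a..t, f (r : S1) = ∫ _r in a..t, v := by
    have hne : ∀ᵐ r : ℝ, r ≠ b := by simp [ae_iff, measure_singleton]
    refine intervalIntegral.integral_congr_ae ?_
    filter_upwards [h, hne] with r hr hrb hrt
    rw [Set.uIoc_of_le ht.1] at hrt
    exact hr ⟨hrt.1, lt_of_le_of_ne (hrt.2.trans ht.2) hrb⟩
  rw [this, intervalIntegral.integral_const]

theorem isDigon_of_ae_eq {x f : S1 → E n} (hx : IsPrimitive x f) {a : ℝ} {v : E n} (hv : ‖v‖ = 1)
    (h1 : ∀ᵐ t : ℝ, t ∈ Set.Ioo a (a + Real.pi) → f (t : S1) = v)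
    (h2 : ∀ᵐ t : ℝ, t ∈ Set.Ioo (a + Real.pi) (a + 2 * Real.pi) → f (t : S1) = -v) :
    IsDigon x a := by
  have e1 : ∀ t ∈ Set.Icc 0 Real.pi, x ((a + t : ℝ) : S1) = x (a : S1) + t • v := fun t ht => by
    rw [hx.eq_add_smul h1 ⟨by linarith [ht.1], by linarith [ht.2]⟩, add_sub_cancel_left]
  refine ⟨v, hv, e1, fun t ht => ?_⟩
  rw [hx.eq_add_smul h2 ⟨by linarith [ht.1], by linarith [ht.2]⟩,
    e1 Real.pi ⟨Real.pi_pos.le, le_rfl⟩, add_assoc, smul_neg, ← sub_eq_add_neg, ← sub_smul]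
  congr 2
  ring

/-- For length π the bounds b - a and 2π - (b - a) coincide, so the triangle inequality is an
equality and the direction is constant. -/
theorem IsMinimizer.exists_sgn_eq_ae {a b : ℝ} (hψ : IsMinimizer ψ) (hE : energy ψ ≤ 1)
    (hab : IsBlock ψ a b) (hl : b - a = Real.pi) :
    ∃ v : E n, ‖v‖ = 1 ∧ (∫ t in a..b, sgn (ψ (t : S1)) = Real.pi • v) ∧
      ∀ᵐ t : ℝ, t ∈ Set.Ioo a b → sgn (ψ (t : S1)) = v := by
  have h1 := hψ.norm_integral_sgn_block hE hab
  rw [hl, show 2 * Real.pi - Real.pi = Real.pi by ring] at h1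
  have h2 : ∫ t in a..b, sgn (ψ (t : S1)) =
      Real.pi • (Real.pi⁻¹ • ∫ t in a..b, sgn (ψ (t : S1))) := by
    rw [smul_smul, mul_inv_cancel₀ Real.pi_pos.ne', one_smul]
  refine ⟨Real.pi⁻¹ • ∫ t in a..b, sgn (ψ (t : S1)), ?_, h2, ?_⟩
  · rw [norm_smul, h1, norm_inv, Real.norm_of_nonneg Real.pi_pos.le,
      inv_mul_cancel₀ Real.pi_pos.ne']
  · rw [← ae_restrict_iff' measurableSet_Ioo]
    refine ae_eq_of_integral_eq ?_ (Filter.Eventually.of_forall fun t => norm_sgn_le _) ?_ ?_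
    · exact ((intervalIntegrable_coe (integrable_sgn hψ.1.memW12.continuous) a b).1).mono_set
        Set.Ioo_subset_Ioc_self
    · rw [norm_smul, h1, norm_inv, Real.norm_of_nonneg Real.pi_pos.le,
        inv_mul_cancel₀ Real.pi_pos.ne']
    · rw [← integral_Ioc_eq_integral_Ioo, ← intervalIntegral.integral_of_le hab.lt.le]
      simp only [measureReal_restrict_apply_univ, Real.volume_real_Ioo_of_le hab.lt.le]
      rw [hl]
      exact h2

end Velocity

/-! ### Regularity of the curve away from the zero set -/

section Regularity

variable {n : ℕ} {ψ g : S1 → E n}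

theorem norm_sgn_sub_sgn_le {m : ℝ} (hm : 0 < m) {u v : E n} (hu : m ≤ ‖u‖) (hv : m ≤ ‖v‖) :
    ‖sgn u - sgn v‖ ≤ 2 / m * ‖u - v‖ := by
  have hu0 : 0 < ‖u‖ := hm.trans_le hu
  have hv0 : 0 < ‖v‖ := hm.trans_le hv
  have h1 : sgn u - sgn v = ‖u‖⁻¹ • ((u - v) + (‖v‖ - ‖u‖) • sgn v) := by
    rw [sub_smul, norm_smul_sgn, smul_add, smul_sub, smul_sub, smul_smul ‖u‖⁻¹ ‖u‖,
      inv_mul_cancel₀ hu0.ne', one_smul, sgn, sgn]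
    abel
  rw [h1, norm_smul, norm_inv, norm_norm]
  have h2 : ‖u - v + (‖v‖ - ‖u‖) • sgn v‖ ≤ 2 * ‖u - v‖ := by
    refine (norm_add_le _ _).trans ?_
    rw [norm_smul, norm_sgn (norm_pos_iff.1 hv0), mul_one, Real.norm_eq_abs]
    have := abs_norm_sub_norm_le v u
    rw [norm_sub_rev v u] at this
    linarith
  calc ‖u‖⁻¹ * ‖u - v + (‖v‖ - ‖u‖) • sgn v‖ ≤ m⁻¹ * (2 * ‖u - v‖) := by
        gcongr
    _ = 2 / m * ‖u - v‖ := by rw [div_eq_mul_inv]; ring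

/-- As sgn is Lipschitz with constant 2/m outside the ball of radius m, sgn ψ inherits an L²
derivative; compactness supplies m in the applications. -/
theorem ftc_sgn (hg : MemLp g 2 volume) (hu : IsPrimitive ψ g) {m c d : ℝ} (hm : 0 < m)
    (hcd : c ≤ d) (h : ∀ t ∈ Set.Icc c d, m ≤ ‖ψ (t : S1)‖) :
    (∀ᵐ t : ℝ, t ∈ Set.Icc c d →
      ‖deriv (fun t : ℝ => sgn (ψ (t : S1))) t‖ ≤ 2 / m * ‖g (t : S1)‖) ∧
    ∀ s ∈ Set.Icc c d, ∀ t ∈ Set.Icc c d, sgn (ψ (t : S1)) - sgn (ψ (s : S1)) =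
      ∫ r in s..t, deriv (fun t : ℝ => sgn (ψ (t : S1))) r := by
  have hi := intervalIntegrable_coe (memLp_two_integrable hg)
  obtain ⟨-, h2, h3⟩ := ftc_of_norm_sub_le (f := fun t : ℝ => sgn (ψ (t : S1)))
    (h := fun t => 2 / m * ‖g (t : S1)‖) hcd ((hi c d).norm.const_mul _)
    (fun s t hs hst ht => by
      refine (norm_sgn_sub_sgn_le hm (h t ⟨hs.trans hst, ht⟩) (h s ⟨hs, hst.trans ht⟩)).trans ?_
      rw [intervalIntegral.integral_const_mul, hu s t]
      exact mul_le_mul_of_nonneg_left (intervalIntegral.norm_integral_le_integral_norm hst)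
        (by positivity))
  refine ⟨?_, h3⟩
  filter_upwards [h2] with t ht htm
  refine (ht htm).trans_eq ?_
  rw [Real.norm_of_nonneg (by positivity)]

theorem memLp_coe_restrict_Icc (hg : MemLp g 2 volume) {c d : ℝ} (h : c ≤ d) :
    MemLp (fun t : ℝ => g (t : S1)) 2 (volume.restrict (Set.Icc c d)) := by
  have h1 := intervalIntegrable_coe (memLp_two_integrable hg) c d
  have hsq : Integrable fun s => ‖g s‖ ^ 2 := hg.integrable_norm_pow (by norm_num)
  have h2 := intervalIntegrable_coe hsq c d
  rw [intervalIntegrable_iff_integrableOn_Icc_of_le h] at h1 h2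
  exact (memLp_two_iff_integrable_sq_norm h1.aestronglyMeasurable).2 h2

theorem memW22Loc_of_isPrimitive {x : S1 → E n} {e : E n} (hW : MemW12 ψ)
    (hx : IsPrimitive x (velocity ψ e)) : MemW22Loc x (zeroSet ψ)ᶜ := by
  intro c d hcd hU
  have hc := hW.continuous
  obtain ⟨g, hg, hu⟩ := hW
  obtain ⟨t₀, ht₀, hmin⟩ := isCompact_Icc.exists_isMinOn (Set.nonempty_Icc.2 hcd)
    (f := fun t : ℝ => ‖ψ (t : S1)‖) ((hc.comp (AddCircle.continuous_mk' _)).norm.continuousOn)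
  have hm : 0 < ‖ψ (t₀ : S1)‖ := norm_pos_iff.2 (hU t₀ ht₀)
  obtain ⟨h1, h2⟩ := ftc_sgn hg hu hm hcd fun t ht => hmin ht
  refine ⟨fun t => sgn (ψ (t : S1)), deriv fun t : ℝ => sgn (ψ (t : S1)), ?_, h2, ?_⟩
  · refine ((memLp_coe_restrict_Icc hg hcd).norm.const_mul (2 / ‖ψ (t₀ : S1)‖)).mono
      (aestronglyMeasurable_deriv _ _) ?_
    filter_upwards [ae_restrict_of_ae h1, ae_restrict_mem measurableSet_Icc] with t ht htm
    refine (ht htm).trans (le_abs_self _)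
  · intro s hs t ht
    rw [hx s t]
    refine intervalIntegral.integral_congr fun r hr => ?_
    exact velocity_of_ne (hU r (Set.uIcc_subset_Icc hs ht hr))

theorem memW22_of_isPrimitive {x : S1 → E n} {e : E n} (hW : MemW12 ψ) (hZ : zeroSet ψ = ∅)
    (hx : IsPrimitive x (velocity ψ e)) : MemW22 x := by
  have hc := hW.continuous
  obtain ⟨g, hg, hu⟩ := hW
  have hne : ∀ s, ψ s ≠ 0 := fun s hs => Set.notMem_empty s (hZ ▸ hs)
  obtain ⟨s₀, -, hmin⟩ := isCompact_univ.exists_isMinOn Set.univ_nonempty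
    (f := fun s : S1 => ‖ψ s‖) hc.norm.continuousOn
  have hm : 0 < ‖ψ s₀‖ := norm_pos_iff.2 (hne s₀)
  have hftc := fun {c d : ℝ} (hcd : c ≤ d) =>
    ftc_sgn hg hu hm hcd fun t _ => hmin (Set.mem_univ (t : S1))
  refine ⟨fun s => sgn (ψ s), ⟨circleDeriv fun s => sgn (ψ s), ?_, ?_⟩, fun a b => ?_⟩
  · refine (hg.norm.const_mul (2 / ‖ψ s₀‖)).mono
      (measurable_circleDeriv _).aestronglyMeasurable ?_
    refine ae_of_ae_coe (P := fun s => ‖circleDeriv (fun s => sgn (ψ s)) s‖ ≤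
      ‖2 / ‖ψ s₀‖ * ‖g s‖‖) ?_
    -- Exhaust the line by countably many intervals to merge the exceptional null sets.
    have hall : ∀ N : ℕ, ∀ᵐ t : ℝ, t ∈ Set.Icc (-N : ℝ) N →
        ‖deriv (fun t : ℝ => sgn (ψ (t : S1))) t‖ ≤ 2 / ‖ψ s₀‖ * ‖g (t : S1)‖ := fun N =>
      (hftc (by linarith [N.cast_nonneg (α := ℝ)])).1
    filter_upwards [ae_all_iff.2 hall] with t ht
    obtain ⟨N, hN⟩ := exists_nat_ge |t|
    rw [circleDeriv_coe]
    exact (ht N (abs_le.1 hN)).trans (le_abs_self _)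
  · intro a b
    simp only [circleDeriv_coe]
    rcases le_total a b with h | h
    · exact (hftc h).2 a ⟨le_rfl, h⟩ b ⟨h, le_rfl⟩
    · exact (hftc h).2 a ⟨h, le_rfl⟩ b ⟨le_rfl, h⟩
  · rw [hx a b]
    exact intervalIntegral.integral_congr fun r _ => velocity_of_ne (hne _)

end Regularity

/-! ### The cases (a), (b), (c1), (c2) -/

section Classification

variable {n : ℕ} {ψ : S1 → E n}

theorem openArc_add_two_pi (a b : ℝ) :
    openArc (a + 2 * Real.pi) (b + 2 * Real.pi) = openArc a b := by
  ext s
  constructor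
  · rintro ⟨t, ht, rfl⟩
    refine ⟨t - 2 * Real.pi, ⟨by linarith [ht.1], by linarith [ht.2]⟩, ?_⟩
    change ((t - 2 * Real.pi : ℝ) : S1) = (t : S1)
    rw [← coe_add_two_pi, sub_add_cancel]
  · rintro ⟨t, ht, rfl⟩
    exact ⟨t + 2 * Real.pi, ⟨by linarith [ht.1], by linarith [ht.2]⟩, coe_add_two_pi t⟩

/-- Case (c1) starts the di-gon with the side over the zero set, [b, b + π], so the block must be
shifted to come after it. -/
theorem IsBlock.add_two_pi {a b : ℝ} (h : IsBlock ψ a b) :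
    IsBlock ψ (a + 2 * Real.pi) (b + 2 * Real.pi) where
  lt := by linarith [h.lt]
  le := by linarith [h.le]
  left := by rw [coe_add_two_pi]; exact h.left
  right := by rw [coe_add_two_pi]; exact h.right
  ne_zero t ht := by
    have := h.ne_zero (t - 2 * Real.pi) ⟨by linarith [ht.1], by linarith [ht.2]⟩
    rwa [← coe_add_two_pi, sub_add_cancel] at this

theorem support_amplitude (ψ : S1 → E n) : Function.support (amplitude ψ) = (zeroSet ψ)ᶜ := by
  ext s
  simp [amplitude, zeroSet]

theorem two_openArcs_compl (a : ℝ) :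
    ({(a : S1), ((a + Real.pi : ℝ) : S1)} : Set S1)ᶜ =
      openArc a (a + Real.pi) ∪ openArc (a + Real.pi) (a + 2 * Real.pi) := by
  have hπ := Real.pi_pos
  ext s
  obtain ⟨t, ht, rfl⟩ := exists_coe_mem_Ioc a s
  rw [Set.mem_compl_iff, Set.mem_insert_iff, Set.mem_singleton_iff, Set.mem_union,
    coe_mem_openArc_iff (by linarith) ht, ← coe_add_two_pi a]
  constructor
  · intro h
    push Not at h
    rcases lt_trichotomy t (a + Real.pi) with h' | h' | h'
    · exact Or.inl h'
    · exact absurd (congrArg _ h') h.2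
    · exact Or.inr ⟨t, ⟨h', lt_of_le_of_ne ht.2 fun h'' => h.1 (congrArg _ h'')⟩, rfl⟩
  · rintro (h | ⟨r, hr, hrt⟩) (h' | h')
    · have := coe_inj_of_mem_Ioc ht ⟨by linarith, le_rfl⟩ h'
      linarith
    · have := coe_inj_of_mem_Ioc ht ⟨by linarith, by linarith⟩ h'
      linarith
    · have h1 := coe_inj_of_mem_Ioc ht ⟨by linarith, le_rfl⟩ h'
      have h2 := coe_inj_of_mem_Ioc (a := a) ⟨by linarith [hr.1], hr.2.le⟩ ht hrt
      linarith [hr.2]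
    · have h1 := coe_inj_of_mem_Ioc ht ⟨by linarith, by linarith⟩ h'
      have h2 := coe_inj_of_mem_Ioc (a := a) ⟨by linarith [hr.1], hr.2.le⟩ ht hrt
      linarith [hr.1]

theorem IsMinimizer.exists_associatedCurve (hn : 1 ≤ n) (hψ : IsMinimizer ψ) (hE : energy ψ ≤ 1) :
    ∃ x : S1 → E n, IsAssociatedCurve ψ x := by
  have hc := hψ.1.memW12.continuous
  obtain ⟨e, he, hN⟩ := exists_direction hn (hψ.norm_integral_sgn_eq hE)
  obtain ⟨x, -, hx⟩ := exists_isPrimitive (integrable_velocity hc e) (integral_velocity hc hN) 0 0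
  exact ⟨x, isAssociatedCurve_of_isPrimitive hc he hx⟩

theorem IsMinimizer.classification (hn : 1 ≤ n) (hψ : IsMinimizer ψ) (hE : energy ψ ≤ 1)
    {x : S1 → E n} (hx : IsAssociatedCurve ψ x) :
    CaseA ψ x ∨ CaseB ψ x ∨ CaseC1 ψ x ∨ CaseC2 ψ x := by
  have hc := hψ.1.memW12.continuous
  have hloop := hψ.norm_integral_sgn_eq hE
  obtain ⟨e, he, hN⟩ := exists_direction hn hloop
  have hp := hx.isPrimitive hc he hN
  have block_velocity : ∀ {a b : ℝ} {v : E n}, IsBlock ψ a b →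
      (∀ᵐ t : ℝ, t ∈ Set.Ioo a b → sgn (ψ (t : S1)) = v) →
      ∀ᵐ t : ℝ, t ∈ Set.Ioo a b → velocity ψ e (t : S1) = v := fun {a b v} hab h => by
    filter_upwards [h] with t ht htm
    rw [velocity_of_ne (hab.ne_zero t htm), ht htm]
  rcases hψ.blocks hE with h | ⟨a, b, hab, hZ⟩ | ⟨a, h1, h2⟩
  · exact Or.inl ⟨h, memW22_of_isPrimitive hψ.1.memW12 h hp⟩
  · have hZ' : zeroSet ψ = arc b (a + 2 * Real.pi) := by rw [hZ, compl_openArc hab.lt hab.le]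
    have hzero : ∀ t ∈ Set.Icc b (a + 2 * Real.pi), ψ (t : S1) = 0 := fun t ht => by
      have : (t : S1) ∈ zeroSet ψ := hZ' ▸ ⟨t, ht, rfl⟩
      exact this
    have hvZ : ∀ᵐ t : ℝ, t ∈ Set.Ioo b (a + 2 * Real.pi) → velocity ψ e (t : S1) = e :=
      Filter.Eventually.of_forall fun t ht => velocity_of_eq (hzero t (Set.Ioo_subset_Icc_self ht))
    -- A block longer than π leaves a zero set shorter than π, case (b); length exactly π is case
    -- (c1).
    rcases (hψ.pi_le_block hE hab).lt_or_eq with hl | hl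
    · refine Or.inr (Or.inl ⟨b, a + 2 * Real.pi, hab.le, by linarith, hZ', hloop,
        ⟨e, he, fun t ht => hp.eq_add_smul hvZ ht⟩, fun s hs => ?_,
        memW22Loc_of_isPrimitive hψ.1.memW12 hp⟩)
      obtain ⟨t, ht, rfl⟩ := hs
      exact norm_eq_zero.2 (hzero t ht)
    · have hba : a + 2 * Real.pi = b + Real.pi := by linarith
      obtain ⟨v, hv, hvi, hva⟩ := hψ.exists_sgn_eq_ae hE hab.add_two_pi (by linarith)
      have hve : v = -e := by
        have h1 : ∫ s, sgn (ψ s) = Real.pi • v := by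
          rw [← hvi, integral_of_eq_zero_off_openArc hab.add_two_pi.lt.le hab.add_two_pi.le]
          intro s hs
          rw [openArc_add_two_pi] at hs
          have : s ∈ zeroSet ψ := hZ ▸ hs
          rw [show ψ s = 0 from this, sgn_zero]
        rw [hN, hZ, measureReal_compl_openArc hab.lt.le hab.le, ← hl,
          show 2 * Real.pi - Real.pi = Real.pi by ring, ← smul_neg] at h1
        exact (smul_right_injective _ Real.pi_pos.ne' h1).symm
      have hv2 := block_velocity hab.add_two_pi hva
      rw [hba, hve] at hv2
      rw [hba] at hvZ
      refine Or.inr (Or.inr (Or.inl ⟨b, by rw [hZ', hba], isDigon_of_ae_eq hp he hvZ hv2, ?_⟩))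
      rw [support_amplitude, hZ, compl_compl, ← hba, openArc_add_two_pi]
  · have hZ := zeroSet_of_two_blocks h1 h2
    obtain ⟨v, hv, hvi, hva⟩ := hψ.exists_sgn_eq_ae hE h1 (by ring)
    obtain ⟨w, hw, hwi, hwa⟩ := hψ.exists_sgn_eq_ae hE h2 (by ring)
    -- The zero set is null, so ∫ sgn ψ = 0 and the contributions πv and πw of the two sides cancel.
    have hwv : w = -v := by
      have i := intervalIntegrable_coe (integrable_sgn hc)
      rw [measureReal_zeroSet_of_two_blocks h1 h2, zero_smul, neg_zero, integral_circle _ a,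
        ← intervalIntegral.integral_add_adjacent_intervals (i a (a + Real.pi)) (i _ _), hvi, hwi,
        ← smul_add] at hN
      exact eq_neg_of_add_eq_zero_right ((smul_eq_zero.1 hN).resolve_left Real.pi_pos.ne')
    rw [hwv] at hwa
    refine Or.inr (Or.inr (Or.inr ⟨a, hZ,
      isDigon_of_ae_eq hp hv (block_velocity h1 hva) (block_velocity h2 hwa), ?_⟩))
    rw [support_amplitude, hZ, two_openArcs_compl]

end Classification

/-! ### A competitor of energy 1 -/

section Competitor

variable {n : ℕ}

/-- The sine wave in one direction, traversing a di-gon. -/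
theorem exists_admissible_energy_eq_one (hn : 1 ≤ n) :
    ∃ ψ : S1 → E n, Admissible ψ ∧ energy ψ = 1 := by
  have hπ := Real.pi_pos
  set v : E n := (√Real.pi)⁻¹ • EuclideanSpace.single ⟨0, hn⟩ 1 with hv
  -- Normalization: sin² and cos² both integrate to π over a period.
  have hvn : ‖v‖ ^ 2 = Real.pi⁻¹ := by
    rw [hv, norm_smul, mul_pow, PiLp.norm_single, norm_one, one_pow, mul_one,
      Real.norm_eq_abs, sq_abs, inv_pow, Real.sq_sqrt hπ.le]
  set ψ : S1 → E n := fun s => Real.sin_periodic.lift s • v with hψ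
  set g : S1 → E n := fun s => Real.cos_periodic.lift s • v with hg
  have hψt : ∀ t : ℝ, ψ (t : S1) = Real.sin t • v := fun t => rfl
  have hgt : ∀ t : ℝ, g (t : S1) = Real.cos t • v := fun t => rfl
  have hgc : Continuous g := continuous_of_continuous_coe (by
    simp only [hgt]; fun_prop)
  have hp : IsPrimitive ψ g := fun a b => by
    simp only [hψt, hgt]
    rw [intervalIntegral.integral_smul_const, integral_cos, sub_smul]
  have hgL := memLp_of_continuous hgc
  refine ⟨ψ, ⟨⟨g, hgL, hp⟩, ?_, ?_⟩, ?_⟩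
  · rw [integral_circle _ 0]
    simp only [hψt, norm_smul, mul_pow, hvn, Real.norm_eq_abs, sq_abs]
    rw [intervalIntegral.integral_mul_const, integral_sin_sq]
    simp
  -- The integrand is odd on the symmetric period [-π, π].
  · have h0 : ∫ s, sgn (ψ s) = 0 := by
      rw [integral_circle _ (-Real.pi), show -Real.pi + 2 * Real.pi = Real.pi by ring]
      have h1 := intervalIntegral.integral_comp_neg (a := -Real.pi) (b := Real.pi)
        (fun t : ℝ => sgn (ψ (t : S1)))
      have h2 : ∀ t : ℝ, sgn (ψ ((-t : ℝ) : S1)) = -sgn (ψ (t : S1)) := fun t => by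
        rw [hψt, hψt, Real.sin_neg, neg_smul, sgn, sgn, norm_neg, smul_neg]
      simp only [h2, neg_neg] at h1
      rw [intervalIntegral.integral_neg] at h1
      rw [eq_comm, eq_neg_iff_add_eq_zero, ← two_smul ℝ] at h1
      exact (smul_eq_zero.1 h1).resolve_left two_ne_zero
    rw [h0, norm_zero]
    exact measureReal_nonneg
  · rw [hp.energy_eq (memLp_two_integrable hgL), integral_circle _ 0]
    simp only [hgt, norm_smul, mul_pow, hvn, Real.norm_eq_abs, sq_abs]
    rw [intervalIntegral.integral_mul_const, integral_cos_sq]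
    simp

end Competitor

/-! ### Compactness and existence of a minimizer -/

section DirectMethod

variable {n : ℕ}

/-- Normalization forces ‖χ‖ ≤ 1 somewhere, since 2π > 1. From there the change is at most ∫ ‖g‖ ≤ ∫
(1 + ‖g‖²)/2. -/
theorem norm_le_of_admissible {χ : S1 → E n} (hχ : Admissible χ) {C : ℝ} (hC : energy χ ≤ C)
    (s : S1) : ‖χ s‖ ≤ 1 + (2 * Real.pi + C) / 2 := by
  have hc := hχ.memW12.continuous
  have hn := hχ.normalized
  obtain ⟨g, hg, hu⟩ := hχ.memW12
  have hgi := memLp_two_integrable hg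
  have hsq : Integrable fun s => ‖g s‖ ^ 2 := hg.integrable_norm_pow (by norm_num)
  obtain ⟨r, hr⟩ : ∃ r, ‖χ r‖ ≤ 1 := by
    by_contra! h
    have h1 : ∫ _s : S1, (1 : ℝ) ≤ ∫ s, ‖χ s‖ ^ 2 :=
      integral_mono (integrable_const _)
        ((memLp_of_continuous hc).integrable_norm_pow (by norm_num)) fun s => by
          have := (h s).le
          simp only
          nlinarith
    rw [hn, integral_const, measureReal_univ_circle, smul_eq_mul, mul_one] at h1
    linarith [Real.pi_gt_three]
  obtain ⟨b, hb, hbs⟩ := exists_coe_mem_Ioc 0 s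
  obtain ⟨a, ha, har⟩ := exists_coe_mem_Ioc 0 r
  have hbound : ∀ a ∈ Set.Ioc 0 (0 + 2 * Real.pi), ∀ b ∈ Set.Ioc 0 (0 + 2 * Real.pi),
      ‖∫ t in a..b, g (t : S1)‖ ≤ (2 * Real.pi + C) / 2 := by
    intro a ha b hb
    have h1 : ‖∫ t in a..b, g (t : S1)‖ ≤ ∫ t in Set.uIoc a b, ‖g (t : S1)‖ :=
      intervalIntegral.norm_integral_le_integral_norm_uIoc
    have hi := (intervalIntegrable_coe hgi 0 (0 + 2 * Real.pi)).norm
    have h2 : ∫ t in Set.uIoc a b, ‖g (t : S1)‖ ≤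
        ∫ t in Set.Ioc 0 (0 + 2 * Real.pi), ‖g (t : S1)‖ := by
      refine setIntegral_mono_set hi.1 (Filter.Eventually.of_forall fun _ => norm_nonneg _) ?_
      refine LE.le.eventuallyLE ?_
      rintro t ⟨ht1, ht2⟩
      exact ⟨(lt_min ha.1 hb.1).trans ht1, ht2.trans (max_le ha.2 hb.2)⟩
    rw [AddCircle.integral_preimage (2 * Real.pi) 0 fun s => ‖g s‖] at h2
    have h3 : ∫ s, ‖g s‖ ≤ ∫ s, (1 + ‖g s‖ ^ 2) / 2 :=
      integral_mono hgi.norm (((integrable_const 1).add hsq).div_const 2) fun s => by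
        simp only
        nlinarith [sq_nonneg (‖g s‖ - 1)]
    rw [integral_div, integral_add (integrable_const 1) hsq, integral_const,
      measureReal_univ_circle, smul_eq_mul, mul_one,
      ← IsPrimitive.energy_eq hu hgi] at h3
    linarith
  have h4 := hu a b
  rw [hbs, har, sub_eq_iff_eq_add'] at h4
  rw [h4]
  exact (norm_add_le _ _).trans (add_le_add hr (hbound a ha b hb))

theorem integral_norm_sgn {χ : S1 → E n} (hχ : Continuous χ) :
    ∫ s, ‖sgn (χ s)‖ = 2 * Real.pi - volume.real (zeroSet χ) := by
  have h : (fun s => ‖sgn (χ s)‖) = (zeroSet χ)ᶜ.indicator fun _ => (1 : ℝ) := by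
    ext1 s
    by_cases hs : χ s = 0
    · rw [Set.indicator_of_notMem (show s ∉ (zeroSet χ)ᶜ from not_not.2 hs), hs, sgn_zero, norm_zero]
    · rw [Set.indicator_of_mem (show s ∈ (zeroSet χ)ᶜ from hs), norm_sgn hs]
  have hZ := measurableSet_zeroSet hχ
  rw [h, integral_indicator hZ.compl, setIntegral_const, smul_eq_mul, mul_one,
    measureReal_compl hZ, measureReal_univ_circle]

/-- The weak loop condition is preserved under pointwise limits. -/
theorem weakLoop_of_tendsto {ψ : S1 → E n} {χ : ℕ → S1 → E n} (hψ : Continuous ψ)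
    (hχ : ∀ k, Continuous (χ k))
    (hloop : ∀ k, ‖∫ s, sgn (χ k s)‖ ≤ volume.real (zeroSet (χ k)))
    (h : ∀ s, Filter.Tendsto (fun k => χ k s) Filter.atTop (nhds (ψ s))) :
    ‖∫ s, sgn (ψ s)‖ ≤ volume.real (zeroSet ψ) := by
  have hZ := measurableSet_zeroSet hψ
  have h1 := tendsto_integral_sgn (l := Filter.atTop) hχ hZ.compl (ψ := ψ) (fun s hs => hs)
    fun s _ => h s
  rw [setIntegral_compl_zeroSet fun s hs => hs] at h1
  have h2 : Filter.Tendsto (fun k => ∫ s in (zeroSet ψ)ᶜ, ‖sgn (χ k s)‖) Filter.atTop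
      (nhds (∫ s in (zeroSet ψ)ᶜ, ‖sgn (ψ s)‖)) := by
    refine tendsto_integral_filter_of_dominated_convergence (fun _ => (1 : ℝ)) ?_ ?_
      (integrable_const _) ?_
    · exact Filter.Eventually.of_forall fun i => (integrable_sgn (hχ i)).1.norm.restrict
    · exact Filter.Eventually.of_forall fun i => Filter.Eventually.of_forall fun s => by
        rw [norm_norm]; exact norm_sgn_le _
    · filter_upwards [ae_restrict_mem hZ.compl] with s hs
      exact ((continuousAt_sgn hs).tendsto.comp (h s)).norm
  have h3 : ∫ s in (zeroSet ψ)ᶜ, ‖sgn (ψ s)‖ = 2 * Real.pi - volume.real (zeroSet ψ) := by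
    rw [← integral_norm_sgn hψ]
    exact setIntegral_eq_integral_of_forall_compl_eq_zero fun s hs => by
      rw [show ψ s = 0 from not_not.1 hs, sgn_zero, norm_zero]
  rw [h3] at h2
  have h4 := h2.const_sub (2 * Real.pi)
  rw [sub_sub_cancel] at h4
  -- For each k, the integral of sgn χₖ over the complement of Z[ψ] has norm at most σ(Z[χₖ]) plus
  -- the integral of ‖sgn χₖ‖ over Z[ψ]. This bound equals 2π minus the integral of ‖sgn χₖ‖ over
  -- the complement, which converges to σ(Z[ψ]).
  refine le_of_tendsto_of_tendsto' h1.norm h4 fun k => ?_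
  have i := integrable_sgn (hχ k)
  have e1 := integral_add_compl hZ i
  have e2 := integral_add_compl hZ i.norm
  rw [integral_norm_sgn (hχ k)] at e2
  have e3 : ∫ s in (zeroSet ψ)ᶜ, sgn (χ k s) =
      (∫ s, sgn (χ k s)) - ∫ s in zeroSet ψ, sgn (χ k s) := by rw [← e1]; abel
  rw [e3]
  have e4 := norm_integral_le_integral_norm (μ := volume.restrict (zeroSet ψ))
    fun s => sgn (χ k s)
  linarith [norm_sub_le (∫ s, sgn (χ k s)) (∫ s in zeroSet ψ, sgn (χ k s)), hloop k]

theorem tendsto_of_tendsto_inner {ι : Type*} {l : Filter ι} {u : ι → E n} {v : E n}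
    (h : ∀ c : E n, Filter.Tendsto (fun k => inner ℝ c (u k)) l (nhds (inner ℝ c v))) :
    Filter.Tendsto u l (nhds v) := by
  rw [(EuclideanSpace.equiv (Fin n) ℝ).toHomeomorph.isInducing.tendsto_nhds_iff, tendsto_pi_nhds]
  intro i
  simpa [EuclideanSpace.inner_single_left] using h (EuclideanSpace.single i 1)

/-- A sequence with bounded energies has a subsequence that converges pointwise to a function of no
larger energy. -/
theorem exists_subseq_tendsto {χ : ℕ → S1 → E n} (hχ : ∀ k, Admissible (χ k)) {l : ℝ}
    (hl : Filter.Tendsto (fun k => energy (χ k)) Filter.atTop (nhds l)) :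
    ∃ (φ : ℕ → ℕ) (ψ : S1 → E n), StrictMono φ ∧ MemW12 ψ ∧ energy ψ ≤ l ∧
      (∃ M, ∀ k s, ‖χ k s‖ ≤ M) ∧
      ∀ s, Filter.Tendsto (fun k => χ (φ k) s) Filter.atTop (nhds (ψ s)) := by
  obtain ⟨C, hC⟩ := hl.bddAbove_range
  have hC' : ∀ k, energy (χ k) ≤ C := fun k => hC ⟨k, rfl⟩
  have hM : ∀ k s, ‖χ k s‖ ≤ 1 + (2 * Real.pi + C) / 2 := fun k s =>
    norm_le_of_admissible (hχ k) (hC' k) s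
  choose g hg hu using fun k => (hχ k).memW12
  set G : ℕ → Lp (E n) 2 (volume : Measure S1) := fun k => (hg k).toLp (g k) with hG
  have hGn : ∀ k, ‖G k‖ ^ 2 = energy (χ k) := fun k => by
    rw [IsPrimitive.energy_eq (hu k) (memLp_two_integrable (hg k)), ← real_inner_self_eq_norm_sq,
      L2.inner_def]
    refine integral_congr_ae ?_
    filter_upwards [(hg k).coeFn_toLp] with s hs
    rw [hs, real_inner_self_eq_norm_sq]
  have hball : ∀ k, StrongDual.toWeakDual (InnerProductSpace.toDual ℝ _ (G k)) ∈
      WeakDual.toStrongDual ⁻¹' Metric.closedBall (0 : StrongDual ℝ (Lp (E n) 2 volume)) √C := by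
    intro k
    rw [Set.mem_preimage, mem_closedBall_zero_iff]
    refine Real.le_sqrt_of_sq_le ?_
    have : ‖InnerProductSpace.toDual ℝ _ (G k)‖ = ‖G k‖ := LinearIsometryEquiv.norm_map _ _
    exact ((congrArg (· ^ 2) this).trans (hGn k)).trans_le (hC' k)
  have : Fact ((2 : ENNReal) ≠ ⊤) := ⟨ENNReal.ofNat_ne_top⟩
  -- Sequential Banach-Alaoglu for the derivatives, read as functionals on L². A further subsequence
  -- makes the values at 0 converge, which fixes the constant of integration.
  obtain ⟨D, -, φ₁, hφ₁, hD⟩ := WeakDual.isSeqCompact_closedBall ℝ _ _ _ hball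
  obtain ⟨c, -, φ₂, hφ₂, hc⟩ := (isCompact_closedBall (0 : E n)
    (1 + (2 * Real.pi + C) / 2)).isSeqCompact (x := fun k => χ (φ₁ k) ((0 : ℝ) : S1))
    fun k => mem_closedBall_zero_iff.2 (hM _ _)
  set φ := φ₁ ∘ φ₂ with hφ
  have hφm : StrictMono φ := hφ₁.comp hφ₂
  set H : Lp (E n) 2 (volume : Measure S1) :=
    (InnerProductSpace.toDual ℝ _).symm (WeakDual.toStrongDual D) with hH
  have hweak : ∀ F : Lp (E n) 2 (volume : Measure S1),
      Filter.Tendsto (fun k => inner ℝ (G (φ k)) F) Filter.atTop (nhds (inner ℝ H F)) := by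
    intro F
    have h1 := ((WeakDual.eval_continuous F).tendsto D).comp (hD.comp hφ₂.tendsto_atTop)
    have h2 : inner ℝ H F = D F := by
      rw [hH, InnerProductSpace.toDual_symm_apply]
      rfl
    rw [h2]
    exact h1
  -- Testing the weak convergence with indicators of arcs yields pointwise convergence of the
  -- primitives.
  have hset : ∀ A : Set S1, MeasurableSet A → Filter.Tendsto (fun k => ∫ s in A, g (φ k) s)
      Filter.atTop (nhds (∫ s in A, H s)) := by
    intro A hA
    refine tendsto_of_tendsto_inner fun c => ?_
    have h1 := hweak (indicatorConstLp 2 hA (measure_ne_top _ _) c)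
    have h2 : ∀ F : Lp (E n) 2 (volume : Measure S1),
        inner ℝ F (indicatorConstLp 2 hA (measure_ne_top _ _) c) = inner ℝ c (∫ s in A, F s) :=
      fun F => by rw [real_inner_comm, L2.inner_indicatorConstLp_eq_inner_setIntegral]
    simp only [h2] at h1
    refine h1.congr fun k => congrArg _ (integral_congr_ae ?_)
    exact ae_restrict_of_ae (hg (φ k)).coeFn_toLp
  have hHL : MemLp H 2 volume := Lp.memLp H
  have hHi := memLp_two_integrable hHL
  have hH0 : ∫ s, H s = 0 := by
    have := hset Set.univ MeasurableSet.univ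
    simp only [setIntegral_univ] at this
    refine tendsto_nhds_unique this ?_
    simp only [(fun k => IsPrimitive.integral_eq_zero (hu k) : ∀ k, ∫ s, g k s = 0)]
    exact tendsto_const_nhds
  obtain ⟨ψ, hψ0, hψ⟩ := exists_isPrimitive hHi hH0 0 c
  refine ⟨φ, ψ, hφm, ⟨H, hHL, hψ⟩, ?_, ⟨_, hM⟩, fun s => ?_⟩
  · have hEψ : energy ψ = ‖H‖ ^ 2 := by
      rw [hψ.energy_eq hHi, ← real_inner_self_eq_norm_sq, L2.inner_def]
      simp only [real_inner_self_eq_norm_sq]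
    have h1 : Filter.Tendsto (fun k => ‖G (φ k)‖) Filter.atTop (nhds √l) := by
      have : (fun k => ‖G (φ k)‖) = fun k => √(energy (χ (φ k))) := funext fun k => by
        rw [← hGn, Real.sqrt_sq (norm_nonneg _)]
      rw [this]
      exact (hl.comp hφm.tendsto_atTop).sqrt
    -- Weak lower semicontinuity of the norm, by pairing with the limit H itself and using
    -- Cauchy-Schwarz.
    have h2 := le_of_tendsto_of_tendsto' (hweak H) (h1.mul_const ‖H‖) fun k =>
      real_inner_le_norm _ _
    rw [real_inner_self_eq_norm_sq] at h2
    have hl0 : 0 ≤ l := ge_of_tendsto' hl fun k => energy_nonneg _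
    have h3 : ‖H‖ ≤ √l := by
      by_contra h
      nlinarith [norm_nonneg H, Real.sqrt_nonneg l]
    rw [hEψ, ← Real.sq_sqrt hl0]
    gcongr
  · obtain ⟨t, ht, rfl⟩ := exists_coe_mem_Ioc 0 s
    have h1 := hset _ (measurableSet_openArc 0 t)
    simp only [setIntegral_openArc _ ht.1.le ht.2] at h1
    have h2 := hc.add h1
    rw [← hψ 0 t, hψ0, add_sub_cancel] at h2
    refine h2.congr fun k => ?_
    have h3 := hu (φ k) 0 t
    rw [← h3]
    simp only [hφ, Function.comp_apply]
    abel

theorem exists_isMinimizer (hn : 1 ≤ n) :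
    ∃ ψ : S1 → E n, IsMinimizer ψ ∧ energy ψ ≤ 1 := by
  obtain ⟨ψ₀, hψ₀, hE₀⟩ := exists_admissible_energy_eq_one hn
  set S : Set ℝ := energy '' {ψ : S1 → E n | Admissible ψ} with hS
  have hSb : BddBelow S := ⟨0, by rintro _ ⟨ψ, -, rfl⟩; exact energy_nonneg ψ⟩
  have hSn : S.Nonempty := ⟨_, ψ₀, hψ₀, rfl⟩
  obtain ⟨u, -, hu, huS⟩ := exists_seq_tendsto_sInf hSn hSb
  choose χ hχ hχu using huS
  have hχ' : ∀ k, Admissible (χ k) := hχ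
  rw [show u = fun k => energy (χ k) from funext fun k => (hχu k).symm] at hu
  obtain ⟨φ, ψ, -, hW, hE, ⟨M, hM⟩, hlim⟩ := exists_subseq_tendsto hχ' hu
  have hc := hW.continuous
  have hck : ∀ k, Continuous (χ k) := fun k => (hχ' k).memW12.continuous
  have hnorm : ∫ s, ‖ψ s‖ ^ 2 = 1 := by
    have h1 : Filter.Tendsto (fun k => ∫ s, ‖χ (φ k) s‖ ^ 2) Filter.atTop
        (nhds (∫ s, ‖ψ s‖ ^ 2)) := by
      refine tendsto_integral_of_dominated_convergence (fun _ => M ^ 2)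
        (fun k => ((hck _).norm.pow 2).aestronglyMeasurable) (integrable_const _)
        (fun k => Filter.Eventually.of_forall fun s => ?_)
        (Filter.Eventually.of_forall fun s => (hlim s).norm.pow 2)
      rw [Real.norm_of_nonneg (by positivity)]
      exact pow_le_pow_left₀ (norm_nonneg _) (hM _ s) 2
    simp only [(hχ' _).normalized] at h1
    exact tendsto_nhds_unique h1 tendsto_const_nhds
  have hadm : Admissible ψ :=
    ⟨hW, hnorm, weakLoop_of_tendsto hc (fun k => hck (φ k)) (fun k => (hχ' _).weakLoop) hlim⟩
  have hmin : IsMinimizer ψ := ⟨hadm, fun η hη => hE.trans (csInf_le hSb ⟨η, hη, rfl⟩)⟩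
  exact ⟨ψ, hmin, (hmin.2 ψ₀ hψ₀).trans hE₀.le⟩

end DirectMethod

end OvalProblem

end

theorem mainTheorem2 (n : ℕ) (hn : 1 ≤ n) :
    (∃ ψ : OvalProblem.S1 → OvalProblem.E n,
      OvalProblem.IsMinimizer ψ ∧ OvalProblem.energy ψ ≤ 1) ∧
    ∀ ψ : OvalProblem.S1 → OvalProblem.E n, OvalProblem.IsMinimizer ψ →
      (∃ x : OvalProblem.S1 → OvalProblem.E n, OvalProblem.IsAssociatedCurve ψ x) ∧
      ∀ x : OvalProblem.S1 → OvalProblem.E n, OvalProblem.IsAssociatedCurve ψ x →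
        OvalProblem.CaseA ψ x ∨ OvalProblem.CaseB ψ x ∨
          OvalProblem.CaseC1 ψ x ∨ OvalProblem.CaseC2 ψ x := by
  obtain ⟨ψ₀, hψ₀, hE₀⟩ := OvalProblem.exists_isMinimizer hn
  refine ⟨⟨ψ₀, hψ₀, hE₀⟩, fun ψ hψ => ?_⟩
  -- All minimizers share the minimal energy, so the bound holds for an arbitrary one.
  have hE : OvalProblem.energy ψ ≤ 1 := (hψ.2 ψ₀ hψ₀.1).trans hE₀
  exact ⟨hψ.exists_associatedCurve hn hE, fun x hx => hψ.classification hn hE hx⟩
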